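/- Let $G$ be a group with neutral element $e$. All rings are associative with $1$; $R=\bigoplus_{g\in G}R_g$ denotes a $G$-graded ring. $R$ is gr-semiprime if it has no nonzero nilpotent graded two-sided ideal; $R$ is right gr-Goldie if it contains no infinite direct sum of nonzero graded right ideals and satisfies the maximal condition on graded right annihilators; a graded ring is gr-semisimple if it is semisimple as a graded right module over itself, i.e. every graded right ideal has a graded complement. Let $S$ be the set of homogeneous regular elements of $R$ and $S_e=S\cap R_e$. The graded classical right quotient ring $Q^{gr}_{cl}(R)$ is the graded right ring of fractions $RS^{-1}$, when it exists; $Q_{cl}$ denotes the (ungraded) classical right quotient ring, the right ring of fractions with respect to all regular elements. **Theorem 1.** The following conditions on $G$ are equivalent: (1) for every $G$-graded gr-semiprime right gr-Goldie ring $R$, the ring $Q^{gr}_{cl}(R)$ exists and is gr-semisimple; (2) $G$ is periodic, i.e. every element of $G$ has finite order. Moreover, if $G$ is periodic, then every $G$-graded gr-semiprime right gr-Goldie ring $R$ satisfies the following condition $(**)$: the ring $Q^{gr}_{cl}(R)$ exists, is gr-semisimple, and equals $RS_e^{-1}$; $S_e$ is exactly the set of regular elements of the ring $R_e$; $R_e$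 is a semiprime right Goldie ring; and $Q_{cl}(R_e)=Q^{gr}_{cl}(R)_e=R_eS_e^{-1}$. -/

import Mathlib

namespace GradedGoldie

/-- The right annihilator `{r | x * r = 0 for all x ∈ X}` of a subset `X` of a ring `R`,
as a right ideal, that is, as an `Rᵐᵒᵖ`-submodule of `R`. -/
def rightAnnihilator {R : Type*} [Ring R] (X : Set R) : Submodule Rᵐᵒᵖ R where
  carrier := {r | ∀ x ∈ X, x * r = 0}
  add_mem' := by
    intro a b ha hb x hx
    rw [mul_add, ha x hx, hb x hx, add_zero]
  zero_mem' := by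
    intro x _
    exact mul_zero x
  smul_mem' := by
    intro c a ha x hx
    rw [MulOpposite.smul_eq_mul_unop, ← mul_assoc, ha x hx, zero_mul]

/-! ### Ungraded notions -/

/-- A ring is semiprime if it has no nonzero nilpotent two-sided ideal. -/
def IsSemiprime (R : Type*) [Ring R] : Prop :=
  ∀ I : Ideal R, I.IsTwoSided → IsNilpotent I → I = ⊥

/-- A right Goldie ring: no infinite direct sum of nonzero right ideals, and the maximal
condition on right annihilators. -/
structure IsRightGoldie (R : Type*) [Ring R] : Prop where
  no_infinite_direct_sum :
    ¬ ∃ I : ℕ → Submodule Rᵐᵒᵖ R, (∀ n, I n ≠ ⊥) ∧ iSupIndep I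
  max_condition :
    ∀ C : Set (Submodule Rᵐᵒᵖ R), C.Nonempty →
      (∀ I ∈ C, ∃ X : Set R, I = rightAnnihilator X) →
      ∃ M, Maximal (· ∈ C) M

/-- `φ : R → Q` exhibits `Q` as the right ring of fractions `R S⁻¹`: elements of `S` become
invertible, every element of `Q` has the form `φ r * (φ s)⁻¹` with `r ∈ R` and `s ∈ S`, and
the kernel of `φ` consists of elements annihilated on the right by an element of `S`. -/
structure IsRightRingOfFractions {R Q : Type*} [Ring R] [Ring Q] (S : Set R)
    (φ : R →+* Q) : Prop where
  isUnit_map : ∀ s ∈ S, IsUnit (φ s)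
  exists_fraction : ∀ q : Q, ∃ r : R, ∃ s ∈ S, q * φ s = φ r
  exists_of_map_eq_zero : ∀ r : R, φ r = 0 → ∃ s ∈ S, r * s = 0

/-- `φ : R → Q` exhibits `Q` as the classical right quotient ring of `R`, the right ring of
fractions with respect to all regular elements. -/
def IsClassicalRightQuotientRing {R Q : Type*} [Ring R] [Ring Q] (φ : R →+* Q) : Prop :=
  IsRightRingOfFractions (nonZeroDivisors R : Set R) φ

/-! ### Graded notions -/

section Graded

variable {ι R : Type*} [DecidableEq ι] [AddGroup ι] [Ring R]
  (𝒜 : ι → AddSubgroup R) [GradedRing 𝒜]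

/-- A graded ring is gr-semiprime if it has no nonzero nilpotent graded two-sided ideal. -/
def IsGrSemiprime : Prop :=
  ∀ I : Ideal R, I.IsTwoSided → I.IsHomogeneous 𝒜 → IsNilpotent I → I = ⊥

/-- A right gr-Goldie ring: no infinite direct sum of nonzero graded right ideals, and the
maximal condition on graded right annihilators. -/
structure IsRightGrGoldie : Prop where
  no_infinite_direct_sum :
    ¬ ∃ I : ℕ → Submodule Rᵐᵒᵖ R,
      (∀ n, (I n).IsHomogeneous 𝒜) ∧ (∀ n, I n ≠ ⊥) ∧ iSupIndep I
  max_condition :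
    ∀ C : Set (Submodule Rᵐᵒᵖ R), C.Nonempty →
      (∀ I ∈ C, I.IsHomogeneous 𝒜 ∧ ∃ X : Set R, I = rightAnnihilator X) →
      ∃ M, Maximal (· ∈ C) M

/-- A graded ring is gr-semisimple if it is semisimple as a graded right module over itself:
every graded right ideal has a complement that is a graded right ideal. -/
def IsGrSemisimple : Prop :=
  ∀ I : Submodule Rᵐᵒᵖ R, I.IsHomogeneous 𝒜 →
    ∃ J : Submodule Rᵐᵒᵖ R, J.IsHomogeneous 𝒜 ∧ IsCompl I J

/-- The set `S` of homogeneous regular elements. -/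
def homogeneousRegular : Set R :=
  {s | SetLike.IsHomogeneousElem 𝒜 s ∧ s ∈ nonZeroDivisors R}

/-- The set `S_e = S ∩ R_e`, where `R_e` is the component of the neutral degree. -/
def neutralRegular : Set R :=
  homogeneousRegular 𝒜 ∩ 𝒜 0

variable {𝒜}
variable {Q : Type*} [Ring Q] {ℬ : ι → AddSubgroup Q} [GradedRing ℬ]

/-- The graded homomorphism `φ : R → Q` exhibits the graded ring `Q` as the graded classical
right quotient ring `R S⁻¹`, with `S` the set of homogeneous regular elements of `R`. -/
def IsGrClassicalRightQuotientRing (φ : 𝒜 →+*ᵍ ℬ) : Prop :=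
  IsRightRingOfFractions (homogeneousRegular 𝒜) φ.toRingHom

end Graded

end GradedGoldie

universe u v

open GradedGoldie

/-! Let `G` be periodic. Everything rests on one observation. By gr-semiprimeness and the maximal
condition, a nonzero homogeneous `a` has a homogeneous multiple `a * y` that is not nilpotent. A
positive power of it has neutral degree, so `y` can be chosen with `a * y` in `R_e` and not
nilpotent (`exists_mul_mem_zero_not_isNilpotent_right`). Goldie's argument then runs with elements
of `R_e`: no nonzero homogeneous element has a gr-essential right annihilator, and every
gr-essential right ideal contains a regular element of neutral degree
(`IsGrEssential.exists_mem_neutralRegular`). Applied to `{t | r * t ∈ s R}`, this gives a right Ore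
condition for `S_e` that respects degrees (`ore_homogeneous`), hence a graded ring `R S_e⁻¹`. It is
gr-semisimple because gr-essential right ideals of `R` generate the unit ideal there, and it inverts
all of `S` because each element of `S` has a power in `S_e`. The same observation carries
regularity, semiprimeness and the Goldie conditions over to `R_e`.

Conversely, let `γ` have infinite order and give `x`, `y` the degrees `γ`, `-γ` in `K[x, y] / (x
y)`. A homogeneous regular element is nonzero on both axes, which forces it to be a scalar. So `R
S⁻¹ = R`, and the ideal of `x` has no complement (`gluedLines.not_exists_grSemisimple_quotient`). -/

namespace GradedGoldie

/-! ### Independence of sequences of submodules -/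

section Lattice

/-- In a vanishing finite sum, the term of least index is minus a sum of later terms, hence zero;
remove it and induct. -/
theorem iSupIndep_nat_of_disjoint_later {R M : Type*} [Ring R] [AddCommGroup M] [Module R M]
    (I : ℕ → Submodule R M) (h : ∀ n, Disjoint (I n) (⨆ m, ⨆ _ : n < m, I m)) :
    iSupIndep I := by
  classical
  rw [iSupIndep_iff_finsetSum_eq_zero_imp_eq_zero]
  intro s v hv
  induction s using Finset.induction_on_min with
  | empty => simp
  | insert a s ha ih =>
    have hnot : a ∉ s := fun h => lt_irrefl _ (ha a h)
    intro hsum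
    rw [Finset.sum_insert hnot] at hsum
    have hmem : ∑ i ∈ s, v i ∈ ⨆ m, ⨆ _ : a < m, I m :=
      Submodule.sum_mem _ fun i hi =>
        (le_iSup₂_of_le (f := fun m (_ : a < m) => I m) i (ha i hi) le_rfl)
          (hv i (Finset.mem_insert_of_mem hi))
    have hva : v a = 0 := by
      refine (Submodule.disjoint_def.1 (h a)) _ (hv a (Finset.mem_insert_self _ _)) ?_
      rw [eq_neg_of_add_eq_zero_left hsum]
      exact neg_mem hmem
    rw [hva, zero_add] at hsum
    intro i hi
    rcases Finset.mem_insert.1 hi with rfl | hi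
    · exact hva
    · exact ih (fun i hi => hv i (Finset.mem_insert_of_mem hi)) hsum i hi

end Lattice

/-! ### Right ideals as modules over the opposite ring -/

section RightIdeals

variable {R : Type*} [Ring R]

theorem mem_rightAnnihilator_singleton {a r : R} : r ∈ rightAnnihilator {a} ↔ a * r = 0 := by
  change (∀ x ∈ ({a} : Set R), x * r = 0) ↔ _
  simp

theorem mul_mem_rightIdeal (I : Submodule Rᵐᵒᵖ R) {a : R} (ha : a ∈ I) (r : R) : a * r ∈ I :=
  I.smul_mem (MulOpposite.op r) ha

theorem mem_span_singleton_right {a x : R} :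
    x ∈ Submodule.span Rᵐᵒᵖ {a} ↔ ∃ r, a * r = x := by
  rw [Submodule.mem_span_singleton]
  exact ⟨fun ⟨c, hc⟩ => ⟨c.unop, hc⟩, fun ⟨r, hr⟩ => ⟨MulOpposite.op r, hr⟩⟩

theorem self_mem_span_singleton_right (a : R) : a ∈ Submodule.span Rᵐᵒᵖ {a} :=
  Submodule.mem_span_singleton_self a

/-- The right ideal `{x | r * x ∈ I}`. -/
def leftMulPreimage (r : R) (I : Submodule Rᵐᵒᵖ R) : Submodule Rᵐᵒᵖ R where
  carrier := {x | r * x ∈ I}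
  add_mem' := fun {a b} ha hb => by
    change r * (a + b) ∈ I
    rw [mul_add]; exact I.add_mem ha hb
  zero_mem' := by simp
  smul_mem' := fun c x hx => by
    change r * (x * c.unop) ∈ I
    rw [← mul_assoc]; exact mul_mem_rightIdeal I hx _

theorem mem_leftMulPreimage {r x : R} {I : Submodule Rᵐᵒᵖ R} :
    x ∈ leftMulPreimage r I ↔ r * x ∈ I := Iff.rfl

end RightIdeals

/-! ### Homogeneous elements, gr-essential right ideals and nilpotence -/

section Graded

variable {ι R : Type*} [DecidableEq ι] [AddGroup ι] [Ring R]
  {𝒜 : ι → AddSubgroup R} [GradedRing 𝒜]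

open DirectSum SetLike

theorem isHomogeneousElem_mul {a b : R} (ha : IsHomogeneousElem 𝒜 a)
    (hb : IsHomogeneousElem 𝒜 b) : IsHomogeneousElem 𝒜 (a * b) := by
  obtain ⟨i, hi⟩ := ha
  obtain ⟨j, hj⟩ := hb
  exact ⟨i + j, mul_mem_graded hi hj⟩

omit [DecidableEq ι] [AddGroup ι] [GradedRing 𝒜] in
theorem isHomogeneousElem_of_mem {i : ι} {a : R} (ha : a ∈ 𝒜 i) : IsHomogeneousElem 𝒜 a := ⟨i, ha⟩

theorem isHomogeneousElem_one : IsHomogeneousElem 𝒜 (1 : R) := ⟨0, one_mem_graded 𝒜⟩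

theorem isHomogeneousElem_pow {a : R} (ha : IsHomogeneousElem 𝒜 a) (n : ℕ) :
    IsHomogeneousElem 𝒜 (a ^ n) := by
  obtain ⟨i, hi⟩ := ha
  exact ⟨n • i, pow_mem_graded n hi⟩

/-- An additive statement holds for all elements as soon as it holds for homogeneous ones. -/
theorem homogeneous_induction {p : R → Prop} (h0 : p 0)
    (hadd : ∀ a b, p a → p b → p (a + b)) (hom : ∀ a, IsHomogeneousElem 𝒜 a → p a) (r : R) :
    p r :=
  DirectSum.Decomposition.inductionOn 𝒜 h0 (fun {i} m => hom m ⟨i, m.2⟩) hadd r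

/-- The grading group is written additively but need not be commutative, so the side of the shift
matters. -/
theorem decompose_mul_left_mem {a : R} {i : ι} (ha : a ∈ 𝒜 i) (b : R) (k : ι) :
    (decompose 𝒜 (a * b) k : R) = a * decompose 𝒜 b (-i + k) := by
  rw [← coe_decompose_mul_add_of_left_mem 𝒜 ha, add_neg_cancel_left]

theorem decompose_mul_right_mem {b : R} {i : ι} (hb : b ∈ 𝒜 i) (a : R) (k : ι) :
    (decompose 𝒜 (a * b) k : R) = decompose 𝒜 a (k + -i) * b := by
  rw [← coe_decompose_mul_add_of_right_mem 𝒜 hb, neg_add_cancel_right]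

theorem eq_zero_of_decompose_eq_zero {x : R} (h : ∀ i, (decompose 𝒜 x i : R) = 0) : x = 0 := by
  classical
  rw [← DirectSum.sum_support_decompose 𝒜 x]
  exact Finset.sum_eq_zero fun i _ => h i

theorem isHomogeneous_rightAnnihilator {X : Set R} (hX : ∀ x ∈ X, IsHomogeneousElem 𝒜 x) :
    (rightAnnihilator X).IsHomogeneous 𝒜 := by
  intro k r hr x hx
  obtain ⟨i, hi⟩ := hX x hx
  have h : x * r = 0 := hr x hx
  have := decompose_mul_left_mem hi r (i + k)
  rw [h, neg_add_cancel_left] at this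
  simpa using this.symm

theorem isHomogeneous_span_singleton {a : R} (ha : IsHomogeneousElem 𝒜 a) :
    (Submodule.span Rᵐᵒᵖ {a}).IsHomogeneous 𝒜 := by
  intro k x hx
  obtain ⟨r, rfl⟩ := mem_span_singleton_right.1 hx
  obtain ⟨i, hi⟩ := ha
  rw [decompose_mul_left_mem hi]
  exact mem_span_singleton_right.2 ⟨_, rfl⟩

theorem mem_of_homogeneous_mul_mem {I : Submodule Rᵐᵒᵖ R} (hI : I.IsHomogeneous 𝒜) {a x : R}
    (ha : IsHomogeneousElem 𝒜 a) (hax : a * x ∈ I) (k : ι) : a * decompose 𝒜 x k ∈ I := by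
  obtain ⟨i, hi⟩ := ha
  have := hI (i + k) hax
  rwa [decompose_mul_left_mem hi, neg_add_cancel_left] at this

/-- A right ideal meeting every nonzero homogeneous principal right ideal in a nonzero
homogeneous element. -/
def IsGrEssential (𝒜 : ι → AddSubgroup R) (I : Submodule Rᵐᵒᵖ R) : Prop :=
  ∀ x, IsHomogeneousElem 𝒜 x → x ≠ 0 → ∃ y, IsHomogeneousElem 𝒜 y ∧ x * y ∈ I ∧ x * y ≠ 0

omit [DecidableEq ι] [AddGroup ι] [GradedRing 𝒜] in
theorem IsGrEssential.mono {I J : Submodule Rᵐᵒᵖ R} (hI : IsGrEssential 𝒜 I) (h : I ≤ J) :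
    IsGrEssential 𝒜 J := fun x hx hx0 =>
  let ⟨y, hy, hyI, hy0⟩ := hI x hx hx0
  ⟨y, hy, h hyI, hy0⟩

theorem IsGrEssential.leftMulPreimage {I : Submodule Rᵐᵒᵖ R} (hI : IsGrEssential 𝒜 I) {r : R}
    (hr : IsHomogeneousElem 𝒜 r) : IsGrEssential 𝒜 (leftMulPreimage r I) := by
  intro x hx hx0
  by_cases h : r * x = 0
  · exact ⟨1, isHomogeneousElem_one, by simp [mem_leftMulPreimage, h], by simpa⟩
  · obtain ⟨y, hy, hyI, hy0⟩ := hI (r * x) (isHomogeneousElem_mul hr hx) h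
    rw [mul_assoc] at hyI hy0
    exact ⟨y, hy, hyI, fun h => hy0 (by rw [h, mul_zero])⟩

/-- If `a R a = 0`, the graded two-sided ideal `R a R` has square zero. -/
theorem eq_zero_of_mul_mul_eq_zero (hsp : IsGrSemiprime 𝒜) {a : R} (ha : IsHomogeneousElem 𝒜 a)
    (h : ∀ u, IsHomogeneousElem 𝒜 u → a * u * a = 0) : a = 0 := by
  have haRa : ∀ u, a * u * a = 0 := fun u => by
    induction u using homogeneous_induction (𝒜 := 𝒜) with
    | h0 => simp
    | hadd x y hx hy => rw [mul_add, add_mul, hx, hy, add_zero]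
    | hom u hu => exact h u hu
  -- The left ideal spanned by the homogeneous elements of `a R` is `R a R`.
  let X : Set R := {x | ∃ y, IsHomogeneousElem 𝒜 y ∧ a * y = x}
  have hX : (Ideal.span X).IsHomogeneous 𝒜 := by
    refine Ideal.homogeneous_span 𝒜 X ?_
    rintro _ ⟨y, hy, rfl⟩
    exact isHomogeneousElem_mul ha hy
  have htwo : (Ideal.span X).IsTwoSided := by
    refine ⟨fun {x} z hx => ?_⟩
    induction hx using Submodule.span_induction with
    | mem x hx =>
      obtain ⟨y, hy, rfl⟩ := hx
      induction z using homogeneous_induction (𝒜 := 𝒜) with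
      | h0 => simp
      | hadd x y hx hy => rw [mul_add]; exact add_mem hx hy
      | hom u hu =>
        exact Ideal.subset_span ⟨y * u, isHomogeneousElem_mul hy hu, (mul_assoc _ _ _).symm⟩
    | zero => simp
    | add x y _ _ hx hy => rw [add_mul]; exact add_mem hx hy
    | smul c x _ hx => rw [smul_eq_mul, mul_assoc]; exact Ideal.mul_mem_left _ _ hx
  have hann : ∀ x ∈ Ideal.span X, ∀ u, a * u * x = 0 := by
    intro x hx
    induction hx using Submodule.span_induction with
    | mem x hx =>
      obtain ⟨y, hy, rfl⟩ := hx
      intro u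
      rw [← mul_assoc, haRa, zero_mul]
    | zero => simp
    | add x y _ _ hx hy => intro u; rw [mul_add, hx, hy, add_zero]
    | smul c x _ hx => intro u; rw [smul_eq_mul, ← mul_assoc, mul_assoc a, hx]
  have hnil : IsNilpotent (Ideal.span X) := by
    refine ⟨2, ?_⟩
    rw [Submodule.pow_succ, Submodule.pow_one, Ideal.zero_eq_bot, eq_bot_iff]
    refine Ideal.mul_le.2 ?_
    intro x hx
    induction hx using Submodule.span_induction with
    | mem x hx =>
      obtain ⟨y, hy, rfl⟩ := hx
      intro x hx
      rw [hann x hx]; exact zero_mem _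
    | zero => simp
    | add x y _ _ hx hy => intro u hu; rw [add_mul]; exact add_mem (hx u hu) (hy u hu)
    | smul c x _ hx =>
      intro u hu; rw [smul_eq_mul, mul_assoc]; exact Ideal.mul_mem_left _ _ (hx u hu)
  have hbot := hsp _ htwo hX hnil
  have : a ∈ Ideal.span X := Ideal.subset_span ⟨1, isHomogeneousElem_one, mul_one a⟩
  rwa [hbot] at this

theorem exists_maximal_rightAnnihilator (hG : IsRightGrGoldie 𝒜) {X : Set R} (hX : X.Nonempty)
    (hom : ∀ x ∈ X, IsHomogeneousElem 𝒜 x) :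
    ∃ a ∈ X, ∀ b ∈ X, rightAnnihilator {a} ≤ rightAnnihilator {b} →
      rightAnnihilator {b} ≤ rightAnnihilator {a} := by
  obtain ⟨M, ⟨a, ha, rfl⟩, hM⟩ := hG.max_condition ((fun x => rightAnnihilator {x}) '' X)
    (hX.image _) (by
      rintro _ ⟨x, hx, rfl⟩
      exact ⟨isHomogeneous_rightAnnihilator (by simpa using hom x hx), _, rfl⟩)
  exact ⟨a, ha, fun b hb hab => hM ⟨b, hb, rfl⟩ hab⟩

/-- Otherwise choose `a ≠ 0` in `R a₀` with maximal right annihilator. For homogeneous `u` with `u a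
≠ 0`, the last nonzero power of the nilpotent `u a` is a left multiple of `a`, so it has the same
annihilator as `a`; that annihilator contains `u a`. Thus `a u a = 0` for all `u`, against
semiprimeness. -/
theorem exists_not_isNilpotent_left (hsp : IsGrSemiprime 𝒜) (hG : IsRightGrGoldie 𝒜) {a₀ : R}
    (ha₀ : IsHomogeneousElem 𝒜 a₀) (h0 : a₀ ≠ 0) :
    ∃ y, IsHomogeneousElem 𝒜 y ∧ ¬ IsNilpotent (y * a₀) := by
  by_contra! hnil
  obtain ⟨a, ⟨⟨z, hz, rfl⟩, hne⟩, hmax⟩ := exists_maximal_rightAnnihilator hG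
    (X := {x | (∃ z, IsHomogeneousElem 𝒜 z ∧ z * a₀ = x) ∧ x ≠ 0})
    ⟨a₀, ⟨1, isHomogeneousElem_one, one_mul _⟩, h0⟩
    (by rintro _ ⟨⟨z, hz, rfl⟩, -⟩; exact isHomogeneousElem_mul hz ha₀)
  refine hne (eq_zero_of_mul_mul_eq_zero hsp (isHomogeneousElem_mul hz ha₀) fun u hu => ?_)
  set a := z * a₀ with ha
  by_contra hau
  have hnilp : IsNilpotent (u * a) := by
    rw [ha, ← mul_assoc]; exact hnil _ (isHomogeneousElem_mul hu hz)
  have hua0 : u * a ≠ 0 := fun h => hau (by rw [mul_assoc, h, mul_zero])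
  have : Nontrivial R := ⟨a, 0, hne⟩
  obtain ⟨k, hk⟩ : ∃ k, nilpotencyClass (u * a) = k + 2 := by
    have h1 : nilpotencyClass (u * a) ≠ 0 := (pos_nilpotencyClass_iff.2 hnilp).ne'
    have h2 : nilpotencyClass (u * a) ≠ 1 := fun h => hua0 (nilpotencyClass_eq_one.1 h)
    exact ⟨nilpotencyClass (u * a) - 2, by omega⟩
  obtain ⟨hpow, hpow'⟩ := (nilpotencyClass_eq_succ_iff (k := k + 1)).1 hk
  have hle := hmax ((u * a) ^ (k + 1))
    ⟨⟨(u * a) ^ k * u * z, isHomogeneousElem_mul (isHomogeneousElem_mul (isHomogeneousElem_pow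
      (isHomogeneousElem_mul hu (isHomogeneousElem_mul hz ha₀)) k) hu) hz, by
      rw [pow_succ, ha]; simp only [mul_assoc]⟩, hpow'⟩ (fun r hr => by
      rw [mem_rightAnnihilator_singleton] at hr ⊢
      rw [pow_succ, mul_assoc, mul_assoc, hr, mul_zero, mul_zero])
  have := hle (mem_rightAnnihilator_singleton.2 (by rw [← pow_succ]; exact hpow) :
    u * a ∈ rightAnnihilator {(u * a) ^ (k + 1)})
  rw [mem_rightAnnihilator_singleton, ← mul_assoc] at this
  exact hau this

theorem exists_not_isNilpotent_right (hsp : IsGrSemiprime 𝒜) (hG : IsRightGrGoldie 𝒜) {a : R}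
    (ha : IsHomogeneousElem 𝒜 a) (h0 : a ≠ 0) :
    ∃ y, IsHomogeneousElem 𝒜 y ∧ ¬ IsNilpotent (a * y) := by
  obtain ⟨y, hy, hn⟩ := exists_not_isNilpotent_left hsp hG ha h0
  refine ⟨y, hy, fun ⟨k, hk⟩ => hn ⟨k + 1, ?_⟩⟩
  rw [pow_succ, ← mul_assoc, mul_pow_mul, hk, mul_zero, zero_mul]

/-- This is the only entry point of periodicity. The exponent `n + 1` keeps the power positive. -/
theorem exists_pow_mem_zero (hp : ∀ g : ι, IsOfFinAddOrder g) {a : R}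
    (ha : IsHomogeneousElem 𝒜 a) : ∃ n, a ^ (n + 1) ∈ 𝒜 0 := by
  obtain ⟨g, hg⟩ := ha
  obtain ⟨n, hn, hng⟩ := isOfFinAddOrder_iff_nsmul_eq_zero.1 (hp g)
  obtain ⟨m, rfl⟩ : ∃ m, n = m + 1 := ⟨n - 1, by omega⟩
  exact ⟨m, hng ▸ pow_mem_graded (m + 1) hg⟩

theorem not_isNilpotent_pow {a : R} (ha : ¬ IsNilpotent a) (n : ℕ) : ¬ IsNilpotent (a ^ n) :=
  fun ⟨k, hk⟩ => ha ⟨n * k, by rw [pow_mul, hk]⟩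

/-! ### Graded Goldie theory: regular elements of neutral degree and the neutral component -/

variable (hp : ∀ g : ι, IsOfFinAddOrder g) (hsp : IsGrSemiprime 𝒜) (hG : IsRightGrGoldie 𝒜)
include hp hsp hG

theorem exists_mul_mem_zero_not_isNilpotent_right {a : R} (ha : IsHomogeneousElem 𝒜 a)
    (h0 : a ≠ 0) : ∃ y, IsHomogeneousElem 𝒜 y ∧ a * y ∈ 𝒜 0 ∧ ¬ IsNilpotent (a * y) := by
  obtain ⟨y, hy, hn⟩ := exists_not_isNilpotent_right hsp hG ha h0
  have hay := isHomogeneousElem_mul ha hy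
  obtain ⟨n, hn0⟩ := exists_pow_mem_zero hp hay
  have heq : (a * y) ^ (n + 1) = a * (y * (a * y) ^ n) := by rw [pow_succ', mul_assoc]
  exact ⟨y * (a * y) ^ n, isHomogeneousElem_mul hy (isHomogeneousElem_pow hay n), heq ▸ hn0,
    heq ▸ not_isNilpotent_pow hn _⟩

omit hp hsp in
theorem exists_rightAnnihilator_pow_stable {a : R} (ha : IsHomogeneousElem 𝒜 a) :
    ∃ n, ∀ m r, a ^ (n + 1 + m) * r = 0 → a ^ (n + 1) * r = 0 := by
  obtain ⟨_, ⟨n, rfl⟩, hmax⟩ := exists_maximal_rightAnnihilator hG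
    (X := Set.range fun n : ℕ => a ^ (n + 1)) (Set.range_nonempty _)
    (by rintro _ ⟨n, rfl⟩; exact isHomogeneousElem_pow ha _)
  refine ⟨n, fun m r hr => ?_⟩
  refine mem_rightAnnihilator_singleton.1 (hmax (a ^ (n + 1 + m)) ⟨n + m, ?_⟩ ?_
    (mem_rightAnnihilator_singleton.2 hr))
  · dsimp only; congr 1; omega
  · intro x hx
    rw [mem_rightAnnihilator_singleton] at hx ⊢
    rw [add_comm, pow_add, mul_assoc, hx, mul_zero]

omit hp hsp in
-- Once the annihilators of the powers of `z` stabilise, a nonzero multiple of `z ^ (n + 1)` cannot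
-- be killed by `z`.
theorem isNilpotent_of_isGrEssential_rightAnnihilator {z : R} (hz : IsHomogeneousElem 𝒜 z)
    (h : IsGrEssential 𝒜 (rightAnnihilator {z})) : IsNilpotent z := by
  obtain ⟨n, hn⟩ := exists_rightAnnihilator_pow_stable hG hz
  by_contra hnil
  obtain ⟨y, hy, hmem, hne⟩ := h (z ^ (n + 1)) (isHomogeneousElem_pow hz _)
    fun h => hnil ⟨_, h⟩
  rw [mem_rightAnnihilator_singleton, ← mul_assoc, ← pow_succ'] at hmem
  exact hne (hn 1 y hmem)

omit hp in
-- A non-nilpotent `x * y` would again have a gr-essential annihilator, since that annihilator is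
-- the preimage of the one of `x` under multiplication by `y`.
theorem eq_zero_of_isGrEssential_rightAnnihilator {x : R} (hx : IsHomogeneousElem 𝒜 x)
    (h : IsGrEssential 𝒜 (rightAnnihilator {x})) : x = 0 := by
  by_contra h0
  obtain ⟨y, hy, hn⟩ := exists_not_isNilpotent_right hsp hG hx h0
  refine hn (isNilpotent_of_isGrEssential_rightAnnihilator hG (isHomogeneousElem_mul hx hy) ?_)
  refine (h.leftMulPreimage hy).mono fun r hr => ?_
  rw [mem_leftMulPreimage, mem_rightAnnihilator_singleton] at hr
  rwa [mem_rightAnnihilator_singleton, mul_assoc]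

omit hp hsp in
-- If `x R` met `s R` trivially, then `x R, s x R, s² x R, …` would be an infinite direct sum.
theorem isGrEssential_span_singleton {s : R} (hs : s ∈ 𝒜 0) (hreg : ∀ r, s * r = 0 → r = 0) :
    IsGrEssential 𝒜 (Submodule.span Rᵐᵒᵖ {s}) := by
  intro x hx hx0
  by_contra! hcon
  have hpow : ∀ n r, s ^ n * r = 0 → r = 0 := fun n => by
    induction n with
    | zero => simp
    | succ n ih => intro r hr; rw [pow_succ, mul_assoc] at hr; exact hreg _ (ih _ hr)
  have hsR := isHomogeneous_span_singleton (isHomogeneousElem_of_mem hs)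
  have key : ∀ r, x * r ∈ Submodule.span Rᵐᵒᵖ {s} → x * r = 0 := by
    classical
    intro r hr
    rw [← DirectSum.sum_support_decompose 𝒜 r, Finset.mul_sum]
    exact Finset.sum_eq_zero fun i _ => hcon _ ⟨i, (decompose 𝒜 r i).2⟩
      (mem_of_homogeneous_mul_mem hsR hx hr i)
  refine hG.no_infinite_direct_sum ⟨fun n => Submodule.span Rᵐᵒᵖ {s ^ n * x}, fun n =>
    isHomogeneous_span_singleton (isHomogeneousElem_mul
      (isHomogeneousElem_pow (isHomogeneousElem_of_mem hs) n) hx), fun n h => ?_, ?_⟩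
  · rw [Submodule.span_singleton_eq_bot] at h
    exact hx0 (hpow n x h)
  · refine iSupIndep_nat_of_disjoint_later _ fun n => Submodule.disjoint_def.2 fun y hy hy' => ?_
    obtain ⟨r, rfl⟩ := mem_span_singleton_right.1 hy
    -- All later summands lie in `s ^ (n + 1) R`; cancelling `s ^ n` brings a common element back to
    -- `x R ∩ s R`.
    have hle : (⨆ m, ⨆ _ : n < m, Submodule.span Rᵐᵒᵖ {s ^ m * x}) ≤
        Submodule.span Rᵐᵒᵖ {s ^ (n + 1)} := by
      refine iSup₂_le fun m hm => ?_
      rw [Submodule.span_singleton_le_iff_mem, mem_span_singleton_right]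
      obtain ⟨d, rfl⟩ := Nat.exists_eq_add_of_lt hm
      exact ⟨s ^ d * x, by rw [← mul_assoc, ← pow_add]; congr 2; omega⟩
    obtain ⟨t, ht⟩ := mem_span_singleton_right.1 (hle hy')
    have hx' : x * r = s * t := by
      rw [← sub_eq_zero]
      refine hpow n _ ?_
      rw [mul_sub, ← mul_assoc, ← mul_assoc, ← pow_succ, ht, sub_self]
    rw [mul_assoc, key r (mem_span_singleton_right.2 ⟨t, hx'.symm⟩), mul_zero]

omit hp in
-- If `x * s = 0`, each component of `x` is killed by the gr-essential right ideal `s R`.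
theorem mem_nonZeroDivisors_of_rightRegular {s : R} (hs : s ∈ 𝒜 0)
    (hreg : ∀ r, s * r = 0 → r = 0) : s ∈ nonZeroDivisors R := by
  refine ⟨hreg, fun x hx => eq_zero_of_decompose_eq_zero (𝒜 := 𝒜) fun i => ?_⟩
  refine eq_zero_of_isGrEssential_rightAnnihilator hsp hG ⟨i, (decompose 𝒜 x i).2⟩
    ((isGrEssential_span_singleton hG hs hreg).mono ?_)
  rw [Submodule.span_singleton_le_iff_mem, mem_rightAnnihilator_singleton]
  have := decompose_mul_right_mem hs x i
  rw [hx, neg_zero, add_zero] at this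
  simpa using this.symm

theorem exists_mem_zero_stable {E : Submodule Rᵐᵒᵖ R} {x : R} (hx : IsHomogeneousElem 𝒜 x)
    (hxE : x ∈ E) (h0 : x ≠ 0) :
    ∃ a ∈ E, a ∈ 𝒜 0 ∧ a ≠ 0 ∧ ∀ r, a * a * r = 0 → a * r = 0 := by
  obtain ⟨y, hy, hy0, hn⟩ := exists_mul_mem_zero_not_isNilpotent_right hp hsp hG hx h0
  obtain ⟨n, hst⟩ := exists_rightAnnihilator_pow_stable hG (isHomogeneousElem_mul hx hy)
  refine ⟨(x * y) ^ (n + 1), ?_, ?_, fun h => hn ⟨_, h⟩, fun r hr => ?_⟩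
  · rw [pow_succ', mul_assoc]
    exact mul_mem_rightIdeal _ hxE _
  · simpa using pow_mem_graded (n + 1) hy0
  · rw [← pow_add] at hr
    exact hst _ _ hr

/-- Graded Goldie: an essential right ideal contains a regular element of degree zero. -/
theorem IsGrEssential.exists_mem_neutralRegular {E : Submodule Rᵐᵒᵖ R}
    (hE : IsGrEssential 𝒜 E) : ∃ s ∈ neutralRegular 𝒜, s ∈ E := by
  -- By essentiality, it is enough that `c` kills no nonzero homogeneous element of `E`.
  suffices h : ∃ c ∈ E, c ∈ 𝒜 0 ∧ ∀ x, IsHomogeneousElem 𝒜 x → x ∈ E → c * x = 0 → x = 0 by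
    obtain ⟨c, hcE, hc0, hc⟩ := h
    refine ⟨c, ⟨⟨⟨0, hc0⟩, mem_nonZeroDivisors_of_rightRegular hsp hG hc0 fun r hr => ?_⟩, hc0⟩,
      hcE⟩
    refine eq_zero_of_decompose_eq_zero (𝒜 := 𝒜) fun i => ?_
    by_contra hne
    obtain ⟨y, hy, hyE, hy0⟩ := hE _ ⟨i, (decompose 𝒜 r i).2⟩ hne
    refine hy0 (hc _ (isHomogeneousElem_mul ⟨i, (decompose 𝒜 r i).2⟩ hy) hyE ?_)
    have := decompose_mul_left_mem hc0 r i
    rw [hr, neg_zero, zero_add] at this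
    rw [← mul_assoc, ← this]
    simp
  by_contra! hcon
  -- If no such `c` exists, any `c` satisfying `P` can be enlarged to `c + a` with `c a = 0`.
  -- Multiplying by `c` gives `c (c + a) = c²`, so the annihilator of `c + a` is the intersection of
  -- those of `c` and `a`, and `P` persists.
  let P : R → Prop := fun c => c ∈ E ∧ c ∈ 𝒜 0 ∧ ∀ r, c * c * r = 0 → c * r = 0
  have hstep : ∀ c : {c // P c}, ∃ a : R, P a ∧ a ≠ 0 ∧ c.1 * a = 0 := by
    rintro ⟨c, hcE, hc0, hcc⟩
    obtain ⟨x, hx, hxE, hcx, hx0⟩ := hcon c hcE hc0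
    obtain ⟨a, ha, ha0, hne, haa⟩ := exists_mem_zero_stable hp hsp hG
      (E := E ⊓ rightAnnihilator {c}) hx ⟨hxE, mem_rightAnnihilator_singleton.2 hcx⟩ hx0
    exact ⟨a, ⟨ha.1, ha0, haa⟩, hne, mem_rightAnnihilator_singleton.1 ha.2⟩
  choose a haP hane hca using hstep
  have hsplit : ∀ (c : {c // P c}) r, (c.1 + a c) * r = 0 → c.1 * r = 0 ∧ a c * r = 0 := by
    intro c r hr
    have h1 : c.1 * r = 0 := by
      refine c.2.2.2 r ?_
      calc c.1 * c.1 * r = c.1 * ((c.1 + a c) * r) - (c.1 * a c) * r := by noncomm_ring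
        _ = 0 := by rw [hr, hca]; simp
    rw [add_mul, h1, zero_add] at hr
    exact ⟨h1, hr⟩
  let next : {c // P c} → {c // P c} := fun c => ⟨c.1 + a c, E.add_mem c.2.1 (haP c).1,
    add_mem c.2.2.1 (haP c).2.1, fun r hr => by
      rw [mul_assoc] at hr
      obtain ⟨h1, h2⟩ := hsplit c _ hr
      have h3 : c.1 * r = 0 := by
        refine c.2.2.2 r ?_
        rw [← h1]
        calc c.1 * c.1 * r = c.1 * ((c.1 + a c) * r) - (c.1 * a c) * r := by noncomm_ring
          _ = _ := by rw [hca]; simp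
      have h4 : a c * r = 0 := by
        refine (haP c).2.2 r ?_
        rw [← h2, add_mul, h3, zero_add, mul_assoc]
      rw [add_mul, h3, h4, add_zero]⟩
  let c : ℕ → {c // P c} := fun n => next^[n] ⟨0, E.zero_mem, zero_mem _, by simp⟩
  have hc : ∀ n, c (n + 1) = next (c n) := fun n => Function.iterate_succ_apply' _ _ _
  have hann : ∀ n d r, (c (n + 1 + d)).1 * r = 0 → a (c n) * r = 0 := by
    intro n d
    induction d with
    | zero => intro r hr; rw [add_zero, hc] at hr; exact (hsplit _ _ hr).2
    | succ d ih => intro r hr; rw [← add_assoc, hc] at hr; exact ih r (hsplit _ _ hr).1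
  refine hG.no_infinite_direct_sum ⟨fun n => Submodule.span Rᵐᵒᵖ {a (c n)}, fun n =>
    isHomogeneous_span_singleton ⟨0, (haP _).2.1⟩, fun n h => hane (c n) (by
      rwa [Submodule.span_singleton_eq_bot] at h), ?_⟩
  -- All later terms are killed by `a (c n)`, so an element `a (c n) * r` of their span satisfies `a
  -- (c n) ^ 2 * r = 0` and vanishes by stability.
  refine iSupIndep_nat_of_disjoint_later _ fun n => Submodule.disjoint_def.2 fun y hy hy' => ?_
  obtain ⟨r, rfl⟩ := mem_span_singleton_right.1 hy
  have hle : (⨆ m, ⨆ _ : n < m, Submodule.span Rᵐᵒᵖ {a (c m)}) ≤ rightAnnihilator {a (c n)} := by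
    refine iSup₂_le fun m hm => ?_
    rw [Submodule.span_singleton_le_iff_mem, mem_rightAnnihilator_singleton]
    obtain ⟨d, rfl⟩ := Nat.exists_eq_add_of_lt hm
    refine hann n d _ ?_
    rw [add_right_comm]
    exact hca _
  have := mem_rightAnnihilator_singleton.1 (hle hy')
  exact (haP _).2.2 r (by rw [mul_assoc]; exact this)

theorem ore_homogeneous {g : ι} {r s : R} (hr : r ∈ 𝒜 g) (hs : s ∈ neutralRegular 𝒜) :
    ∃ s' ∈ neutralRegular 𝒜, ∃ r' ∈ 𝒜 g, r * s' = s * r' := by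
  obtain ⟨s', hs', hmem⟩ := IsGrEssential.exists_mem_neutralRegular hp hsp hG
    ((isGrEssential_span_singleton hG hs.2 hs.1.2.1).leftMulPreimage ⟨g, hr⟩)
  obtain ⟨t, ht⟩ := mem_span_singleton_right.1 hmem
  -- Since `s` and `s'` have neutral degree, `t` may be replaced by its component of degree `g`.
  refine ⟨s', hs', decompose 𝒜 t g, (decompose 𝒜 t g).2, ?_⟩
  have h := decompose_mul_left_mem hs.2 t g
  rw [neg_zero, zero_add] at h
  rw [← h, ht, decompose_of_mem_same]
  simpa using mul_mem_graded hr hs'.2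

omit hp hsp hG in
theorem mul_mem_neutralRegular {s t : R} (hs : s ∈ neutralRegular 𝒜)
    (ht : t ∈ neutralRegular 𝒜) : s * t ∈ neutralRegular 𝒜 :=
  ⟨⟨isHomogeneousElem_mul hs.1.1 ht.1.1, mul_mem hs.1.2 ht.1.2⟩, by
    simpa using mul_mem_graded hs.2 ht.2⟩

omit hp hsp hG in
theorem one_mem_neutralRegular : (1 : R) ∈ neutralRegular 𝒜 :=
  ⟨⟨isHomogeneousElem_one, one_mem _⟩, one_mem_graded 𝒜⟩

theorem ore_neutralRegular (r : R) :
    ∀ s ∈ neutralRegular 𝒜, ∃ s' ∈ neutralRegular 𝒜, ∃ r', r * s' = s * r' := by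
  induction r using homogeneous_induction (𝒜 := 𝒜) with
  | h0 => exact fun s _ => ⟨1, one_mem_neutralRegular, 0, by simp⟩
  | hadd a b ha hb =>
    intro s hs
    obtain ⟨s₁, hs₁, a', ha'⟩ := ha s hs
    obtain ⟨s₂, hs₂, b', hb'⟩ := hb s hs
    -- A common right multiple of `s₁` and `s₂` serves both summands.
    obtain ⟨t, ht, u, -, htu⟩ := ore_homogeneous hp hsp hG hs₁.2 hs₂
    refine ⟨s₁ * t, mul_mem_neutralRegular hs₁ ht, a' * t + b' * u, ?_⟩
    rw [add_mul, mul_add, ← mul_assoc, ha', htu, ← mul_assoc, hb', mul_assoc, mul_assoc]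
  | hom a ha =>
    intro s hs
    obtain ⟨g, hg⟩ := ha
    obtain ⟨s', hs', r', -, h⟩ := ore_homogeneous hp hsp hG hg hs
    exact ⟨s', hs', r', h⟩

theorem coe_preimage_neutralRegular :
    ((↑) : 𝒜 0 → R) ⁻¹' neutralRegular 𝒜 = (nonZeroDivisors (𝒜 0) : Set (𝒜 0)) := by
  ext s
  constructor
  · rintro ⟨⟨-, h1, h2⟩, -⟩
    exact ⟨fun x hx => Subtype.ext (h1 x (congrArg Subtype.val hx)),
      fun x hx => Subtype.ext (h2 x (congrArg Subtype.val hx))⟩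
  · rintro ⟨h1, -⟩
    refine ⟨⟨⟨0, s.2⟩, mem_nonZeroDivisors_of_rightRegular hsp hG s.2 fun r hr => ?_⟩, s.2⟩
    refine eq_zero_of_decompose_eq_zero (𝒜 := 𝒜) fun i => ?_
    by_contra hne
    obtain ⟨y, hy, hy0, hn⟩ := exists_mul_mem_zero_not_isNilpotent_right hp hsp hG
      ⟨i, (decompose 𝒜 r i).2⟩ hne
    refine hn ?_
    have h : s * (⟨_, hy0⟩ : 𝒜 0) = 0 := Subtype.ext (by
      change (s : R) * (decompose 𝒜 r i * y) = 0
      have := decompose_mul_left_mem s.2 r i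
      rw [hr, neg_zero, zero_add] at this
      rw [← mul_assoc, ← this]; simp)
    exact ⟨1, by rw [pow_one]; exact congrArg Subtype.val (h1 _ h)⟩

theorem isSemiprime_zero : IsSemiprime (𝒜 0) := by
  rintro I hI ⟨n, hn⟩
  rw [eq_bot_iff]
  intro x hx
  rw [Ideal.mem_bot]
  by_contra h0
  obtain ⟨y, ⟨g, hg⟩, hy0, hnil⟩ := exists_mul_mem_zero_not_isNilpotent_right hp hsp hG
    ⟨0, x.2⟩ (fun h => h0 (Subtype.ext h))
  refine hnil ⟨n, ?_⟩
  -- Only the neutral part of `y` contributes, which places `x * y` in `I`, where everything is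
  -- nilpotent.
  have hxy : (x : R) * y = x * decompose 𝒜 y 0 := by
    have := decompose_mul_left_mem x.2 y 0
    rw [neg_zero, zero_add, decompose_of_mem_same 𝒜 hy0] at this
    exact this
  have hmem : x * decompose 𝒜 y 0 ∈ I := I.mul_mem_right _ hx
  have := Ideal.pow_mem_pow hmem n
  rw [hn, Ideal.zero_eq_bot, Ideal.mem_bot] at this
  rw [hxy]
  exact congrArg Subtype.val this

/-- The extension `I R` of a right ideal `I` of the neutral component. -/
def extendRight (𝒜 : ι → AddSubgroup R) [GradedRing 𝒜] (I : Submodule (𝒜 0)ᵐᵒᵖ (𝒜 0)) :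
    Submodule Rᵐᵒᵖ R :=
  Submodule.span Rᵐᵒᵖ ((↑) '' (I : Set (𝒜 0)))

omit hp hsp hG in
theorem isHomogeneous_extendRight (I : Submodule (𝒜 0)ᵐᵒᵖ (𝒜 0)) :
    (extendRight 𝒜 I).IsHomogeneous 𝒜 := by
  -- The extra factor `c` absorbs the scalars in the span induction.
  suffices h : ∀ x ∈ extendRight 𝒜 I, ∀ c k, (decompose 𝒜 (x * c) k : R) ∈ extendRight 𝒜 I by
    intro k x hx
    simpa using h x hx 1 k
  intro x hx
  induction hx using Submodule.span_induction with
  | mem x hx =>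
    obtain ⟨y, hy, rfl⟩ := hx
    intro c k
    rw [decompose_mul_left_mem y.2]
    exact mul_mem_rightIdeal _ (Submodule.subset_span (Set.mem_image_of_mem _ hy)) _
  | zero => simp
  | add x y _ _ hx hy =>
    intro c k
    rw [add_mul, decompose_add]; exact add_mem (hx c k) (hy c k)
  | smul d x _ hx =>
    intro c k
    rw [MulOpposite.smul_eq_mul_unop, mul_assoc]; exact hx _ k

omit hp hsp hG in
theorem mem_of_coe_mem_extendRight {I : Submodule (𝒜 0)ᵐᵒᵖ (𝒜 0)} {x : 𝒜 0}
    (hx : (x : R) ∈ extendRight 𝒜 I) : x ∈ I := by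
  suffices h : ∀ x ∈ extendRight 𝒜 I, ∀ c : R, decompose 𝒜 (x * c) 0 ∈ I by
    have := h x hx 1
    rwa [mul_one, decompose_coe, DirectSum.of_eq_same] at this
  clear hx x
  intro x hx
  induction hx using Submodule.span_induction with
  | mem x hx =>
    obtain ⟨y, hy, rfl⟩ := hx
    intro c
    have h : decompose 𝒜 ((y : R) * c) 0 = y * decompose 𝒜 c 0 := Subtype.ext (by
      rw [decompose_mul_left_mem y.2, neg_zero, zero_add]; rfl)
    rw [h]
    exact mul_mem_rightIdeal _ hy _
  | zero => simp
  | add x y _ _ hx hy =>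
    intro c
    rw [add_mul, decompose_add]; exact add_mem (hx c) (hy c)
  | smul d x _ hx =>
    intro c
    rw [MulOpposite.smul_eq_mul_unop, mul_assoc]; exact hx _

/-- A nonzero component of a common element has a non-nilpotent multiple in `R_e`, which by
contraction lies in both `I` and `J`. -/
theorem disjoint_extendRight {I J : Submodule (𝒜 0)ᵐᵒᵖ (𝒜 0)} (h : Disjoint I J) :
    Disjoint (extendRight 𝒜 I) (extendRight 𝒜 J) := by
  refine Submodule.disjoint_def.2 fun x hx hx' =>
    eq_zero_of_decompose_eq_zero (𝒜 := 𝒜) fun i => ?_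
  by_contra hne
  obtain ⟨y, -, hy0, hn⟩ := exists_mul_mem_zero_not_isNilpotent_right hp hsp hG
    ⟨i, (decompose 𝒜 x i).2⟩ hne
  have h1 := mul_mem_rightIdeal _ (isHomogeneous_extendRight I i hx) y
  have h2 := mul_mem_rightIdeal _ (isHomogeneous_extendRight J i hx') y
  have h3 := Submodule.disjoint_def.1 h ⟨_, hy0⟩ (mem_of_coe_mem_extendRight h1)
    (mem_of_coe_mem_extendRight h2)
  exact hn ⟨1, by rw [pow_one]; exact congrArg Subtype.val h3⟩

omit hp hsp hG in
theorem extendRight_mono {I J : Submodule (𝒜 0)ᵐᵒᵖ (𝒜 0)} (h : I ≤ J) :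
    extendRight 𝒜 I ≤ extendRight 𝒜 J :=
  Submodule.span_mono (Set.image_mono h)

theorem isRightGoldie_zero : IsRightGoldie (𝒜 0) where
  no_infinite_direct_sum := by
    rintro ⟨I, hI, hind⟩
    refine hG.no_infinite_direct_sum ⟨fun n => extendRight 𝒜 (I n), fun n =>
      isHomogeneous_extendRight _, fun n h => hI n ?_, fun n => ?_⟩
    · rw [eq_bot_iff]
      intro x hx
      have : (x : R) ∈ extendRight 𝒜 (I n) := Submodule.subset_span ⟨x, hx, rfl⟩
      rw [show extendRight 𝒜 (I n) = ⊥ from h] at this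
      exact Subtype.ext this
    · exact (disjoint_extendRight hp hsp hG (hind n)).mono_right
        (iSup₂_le fun m hm => extendRight_mono (le_iSup₂_of_le m hm le_rfl))
  max_condition := by
    intro C hC hann
    -- With `L I` the left annihilator of `I` in `R_e`, an annihilator `I` is recovered as the part
    -- of `rightAnnihilator (L I)` in `R_e`, so maximality descends.
    let L : Submodule (𝒜 0)ᵐᵒᵖ (𝒜 0) → Set R := fun I =>
      (↑) '' {x : 𝒜 0 | ∀ y ∈ I, x * y = 0}
    obtain ⟨M, ⟨I, hI, rfl⟩, hM⟩ := hG.max_condition ((fun I => rightAnnihilator (L I)) '' C)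
      (hC.image _) (by
        rintro _ ⟨I, hI, rfl⟩
        refine ⟨isHomogeneous_rightAnnihilator ?_, _, rfl⟩
        rintro _ ⟨x, -, rfl⟩
        exact ⟨0, x.2⟩)
    refine ⟨I, hI, fun J hJ hIJ y hy => ?_⟩
    obtain ⟨X, rfl⟩ := hann I hI
    have hle := hM ⟨J, hJ, rfl⟩ (fun r hr x hx => hr x (by
      obtain ⟨z, hz, rfl⟩ := hx
      exact ⟨z, fun y hy => hz y (hIJ hy), rfl⟩))
    have hyJ : (y : R) ∈ rightAnnihilator (L J) := by
      rintro _ ⟨z, hz, rfl⟩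
      exact congrArg Subtype.val (hz y hy)
    intro x hx
    exact Subtype.ext (hle hyJ x ⟨x, fun z hz => hz x hx, rfl⟩)

end Graded
end GradedGoldie

namespace GradedGoldie

open DirectSum SetLike

/-! ### Right Ore localization at regular elements -/

section Fractions

theorem exists_isRightRingOfFractions {R : Type v} [Ring R] (S : Submonoid R)
    (hS : S ≤ nonZeroDivisors R)
    (ore : ∀ r, ∀ s ∈ S, ∃ s' ∈ S, ∃ r', r * s' = s * r') :
    ∃ (Q : Type v) (_ : Ring Q) (φ : R →+* Q),
      IsRightRingOfFractions (S : Set R) φ ∧ Function.Injective φ := by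
  choose d hd n hdn using ore
  -- Right fractions over `R` are the opposite of left fractions over `Rᵐᵒᵖ`.
  let : OreLocalization.OreSet S.op :=
    { ore_right_cancel := fun a b s h => ⟨1, by
        have h' : s.1.unop * (a.unop - b.unop) = 0 := by
          rw [mul_sub, sub_eq_zero]; exact congrArg MulOpposite.unop h
        have := sub_eq_zero.1 ((hS s.2).1 _ h')
        rw [MulOpposite.unop_injective this]⟩
      oreNum := fun r s => MulOpposite.op (n r.unop s.1.unop s.2)
      oreDenom := fun r s => ⟨MulOpposite.op (d r.unop s.1.unop s.2), hd _ _ _⟩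
      ore_eq := fun r s => MulOpposite.unop_injective (hdn r.unop s.1.unop s.2) }
  let ψ : Rᵐᵒᵖ →+* OreLocalization S.op Rᵐᵒᵖ := OreLocalization.numeratorRingHom
  have hψ : Function.Injective ψ := OreLocalization.numeratorHom_inj fun a ha b hab =>
    MulOpposite.unop_injective ((hS ha).2 _ (congrArg MulOpposite.unop hab))
  let φ : R →+* (OreLocalization S.op Rᵐᵒᵖ)ᵐᵒᵖ :=
    (RingHom.op ψ).comp (RingEquiv.opOp R : R →+* Rᵐᵒᵖᵐᵒᵖ)
  have hφ : ∀ r, φ r = MulOpposite.op (ψ (MulOpposite.op r)) := fun _ => rfl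
  have hinj : Function.Injective φ := fun a b h =>
    MulOpposite.op_injective (hψ (MulOpposite.op_injective h))
  refine ⟨_, inferInstance, φ, ⟨fun s hs => ?_, fun q => ?_, fun r hr => ?_⟩, hinj⟩
  · rw [hφ]
    exact (OreLocalization.numerator_isUnit (⟨MulOpposite.op s, hs⟩ : S.op)).op
  · induction q using MulOpposite.rec' with
    | h q =>
      induction q using OreLocalization.ind with
      | c r s =>
        refine ⟨r.unop, s.1.unop, s.2, MulOpposite.unop_injective ?_⟩
        change OreLocalization.oreDiv s.1 1 * OreLocalization.oreDiv r s =
          OreLocalization.oreDiv r 1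
        exact OreLocalization.mul_cancel
  · exact ⟨1, S.one_mem, by rw [mul_one]; exact hinj (hr.trans φ.map_zero.symm)⟩

end Fractions

/-! ### The grading on the ring of fractions -/

section Grading

variable {ι R Q : Type*} [DecidableEq ι] [AddGroup ι] [Ring R] [Ring Q]
  {𝒜 : ι → AddSubgroup R} [GradedRing 𝒜] {φ : R →+* Q}

/-- The submonoid of regular elements of neutral degree. -/
def neutralRegularSubmonoid (𝒜 : ι → AddSubgroup R) [GradedRing 𝒜] : Submonoid R where
  carrier := neutralRegular 𝒜
  mul_mem' := mul_mem_neutralRegular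
  one_mem' := one_mem_neutralRegular

/-- The homogeneous right Ore condition for the regular elements of neutral degree. -/
def HomogeneousOre (𝒜 : ι → AddSubgroup R) : Prop :=
  ∀ ⦃g⦄, ∀ r ∈ 𝒜 g, ∀ s ∈ neutralRegular 𝒜, ∃ s' ∈ neutralRegular 𝒜, ∃ r' ∈ 𝒜 g,
    r * s' = s * r'

/-- Denominators are merged one at a time by the Ore condition; all multipliers have neutral degree,
so the numerators keep their degrees. -/
theorem exists_common_denominator (hore : HomogeneousOre 𝒜) {κ : Type*} (T : Finset κ)
    (deg : κ → ι) (q : κ → Q)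
    (hq : ∀ i ∈ T, ∃ s ∈ neutralRegular 𝒜, ∃ r ∈ 𝒜 (deg i), q i * φ s = φ r) :
    ∃ s ∈ neutralRegular 𝒜, ∀ i ∈ T, ∃ r ∈ 𝒜 (deg i), q i * φ s = φ r := by
  classical
  induction T using Finset.induction_on with
  | empty => exact ⟨1, one_mem_neutralRegular, by simp⟩
  | insert a T ha ih =>
    obtain ⟨s, hs, h⟩ := ih fun i hi => hq i (Finset.mem_insert_of_mem hi)
    obtain ⟨t, ht, r, hr, hqr⟩ := hq a (Finset.mem_insert_self _ _)
    obtain ⟨s', hs', t', ht', hst⟩ := hore s hs.2 t ht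
    refine ⟨s * s', mul_mem_neutralRegular hs hs', fun i hi => ?_⟩
    rcases Finset.mem_insert.1 hi with rfl | hi
    · refine ⟨r * t', by simpa using mul_mem_graded hr ht', ?_⟩
      rw [hst, map_mul, ← mul_assoc, hqr, map_mul]
    · obtain ⟨r, hr, hqr⟩ := h i hi
      refine ⟨r * s', by simpa using mul_mem_graded hr hs'.2, ?_⟩
      rw [map_mul, ← mul_assoc, hqr, map_mul]

/-- The component of degree `g` of the ring of fractions: the fractions `r s⁻¹` with `r` of
degree `g` and `s` regular of neutral degree. -/
def fractionComponent (hore : HomogeneousOre 𝒜) (φ : R →+* Q) (g : ι) : AddSubgroup Q where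
  carrier := {q | ∃ s ∈ neutralRegular 𝒜, ∃ r ∈ 𝒜 g, q * φ s = φ r}
  zero_mem' := ⟨1, one_mem_neutralRegular, 0, zero_mem _, by simp⟩
  add_mem' := by
    intro a b ha hb
    obtain ⟨s, hs, h⟩ := exists_common_denominator hore Finset.univ (fun _ : Bool => g)
      (fun i => cond i a b) (by rintro (_ | _) -; exacts [hb, ha])
    obtain ⟨r₁, hr₁, h₁⟩ := h true (Finset.mem_univ _)
    obtain ⟨r₂, hr₂, h₂⟩ := h false (Finset.mem_univ _)
    exact ⟨s, hs, r₁ + r₂, add_mem hr₁ hr₂, by rw [add_mul, map_add, ← h₁, ← h₂]; rfl⟩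
  neg_mem' := by
    rintro a ⟨s, hs, r, hr, h⟩
    exact ⟨s, hs, -r, neg_mem hr, by rw [neg_mul, h, map_neg]⟩

theorem map_mem_fractionComponent (hore : HomogeneousOre 𝒜) (φ : R →+* Q) {g : ι} {r : R}
    (hr : r ∈ 𝒜 g) : φ r ∈ fractionComponent hore φ g :=
  ⟨1, one_mem_neutralRegular, r, hr, by simp⟩

theorem gradedMonoid_fractionComponent (hore : HomogeneousOre 𝒜) (φ : R →+* Q) :
    GradedMonoid (fractionComponent hore φ) where
  one_mem := by simpa using map_mem_fractionComponent hore φ (one_mem_graded 𝒜)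
  mul_mem := by
    rintro i j a b ⟨s, hs, r, hr, h⟩ ⟨t, ht, u, hu, h'⟩
    obtain ⟨s', hs', u', hu', hsu⟩ := hore u hu s hs
    refine ⟨t * s', mul_mem_neutralRegular ht hs', r * u', mul_mem_graded hr hu', ?_⟩
    calc a * b * φ (t * s') = a * (b * φ t) * φ s' := by rw [map_mul]; noncomm_ring
      _ = a * φ (u * s') := by rw [h', map_mul, mul_assoc]
      _ = (a * φ s) * φ u' := by rw [hsu, map_mul, mul_assoc]
      _ = φ (r * u') := by rw [h, map_mul]

theorem isInternal_fractionComponent (hore : HomogeneousOre 𝒜) (hinj : Function.Injective φ)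
    (hφ : IsRightRingOfFractions (neutralRegular 𝒜) φ) :
    IsInternal (fractionComponent hore φ) := by
  classical
  constructor
  · rw [injective_iff_map_eq_zero]
    intro f hf
    rw [DirectSum.coeAddMonoidHom_eq_dfinsuppSum, DFinsupp.sum] at hf
    obtain ⟨s, hs, h⟩ := exists_common_denominator (φ := φ) hore f.support id
      (fun i => (f i : Q)) fun i _ => (f i).2
    choose! r hr hfr using h
    simp only [id] at hr
    -- Clearing the common denominator turns the relation into one between homogeneous elements of
    -- `R`.
    have hsum : ∑ i ∈ f.support, r i = 0 := hinj (by
      rw [map_sum, map_zero, ← Finset.sum_congr rfl hfr, ← Finset.sum_mul, hf, zero_mul])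
    ext i
    by_cases hi : i ∈ f.support
    · have hri : r i = 0 := by
        have := congrArg (GradedRing.proj 𝒜 i) hsum
        simp only [map_sum, map_zero, GradedRing.proj_apply] at this
        rw [Finset.sum_eq_single_of_mem i hi fun j hj hji => decompose_of_mem_ne 𝒜 (hr j hj) hji,
          decompose_of_mem_same 𝒜 (hr i hi)] at this
        exact this
      have := hfr i hi
      rw [hri, map_zero, (hφ.isUnit_map s hs).mul_left_eq_zero] at this
      simpa using this
    · rw [DFinsupp.notMem_support_iff.1 hi]
      rfl
  · intro q
    obtain ⟨r, s, hs, h⟩ := hφ.exists_fraction q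
    obtain ⟨u, hu⟩ := hφ.isUnit_map s hs
    have hq : q = φ r * ↑u⁻¹ := by rw [← h, ← hu, mul_assoc, Units.mul_inv, mul_one]
    rw [hq]
    change _ ∈ (DirectSum.coeAddMonoidHom (fractionComponent hore φ)).range
    clear h hq
    induction r using homogeneous_induction (𝒜 := 𝒜) with
    | h0 => rw [map_zero, zero_mul]; exact zero_mem _
    | hadd a b ha hb => rw [map_add, add_mul]; exact add_mem ha hb
    | hom a ha =>
      obtain ⟨g, hg⟩ := ha
      exact ⟨DirectSum.of (fun i => fractionComponent hore φ i) g
        ⟨_, s, hs, a, hg, by rw [← hu, mul_assoc, Units.inv_mul, mul_one]⟩,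
        DirectSum.coeAddMonoidHom_of _ _ _⟩

/-- The ring of fractions as a graded ring. -/
@[reducible]
noncomputable def fractionGradedRing (hore : HomogeneousOre 𝒜) (hinj : Function.Injective φ)
    (hφ : IsRightRingOfFractions (neutralRegular 𝒜) φ) :
    GradedRing (fractionComponent hore φ) :=
  { gradedMonoid_fractionComponent hore φ,
    (isInternal_fractionComponent hore hinj hφ).chooseDecomposition with }

end Grading

/-! ### Semisimplicity and the neutral component of the quotient ring -/

section Consequences

variable {ι R Q : Type*} [DecidableEq ι] [AddGroup ι] [Ring R] [Ring Q]
  {𝒜 : ι → AddSubgroup R} [GradedRing 𝒜] {ℬ : ι → AddSubgroup Q} [GradedRing ℬ]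

theorem exists_maximal_homogeneous_disjoint (I : Submodule Qᵐᵒᵖ Q) :
    ∃ J, Maximal (fun J : Submodule Qᵐᵒᵖ Q => J.IsHomogeneous ℬ ∧ Disjoint I J) J := by
  have hbot : (⊥ : Submodule Qᵐᵒᵖ Q).IsHomogeneous ℬ ∧ Disjoint I ⊥ := by
    refine ⟨fun k x hx => ?_, disjoint_bot_right⟩
    rw [(Submodule.mem_bot _).1 hx]
    simp
  obtain ⟨J, -, hJ⟩ := zorn_le_nonempty₀
    {J : Submodule Qᵐᵒᵖ Q | J.IsHomogeneous ℬ ∧ Disjoint I J} (fun c hc hchain y hy => by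
      have hmem : ∀ x, x ∈ sSup c ↔ ∃ J ∈ c, x ∈ J := fun x =>
        Submodule.mem_sSup_of_directed ⟨y, hy⟩ hchain.directedOn
      refine ⟨sSup c, ⟨fun k x hx => ?_, ?_⟩, fun z hz => le_sSup hz⟩
      · obtain ⟨J, hJ, hxJ⟩ := (hmem x).1 hx
        exact (hmem _).2 ⟨J, hJ, (hc hJ).1 k hxJ⟩
      · refine Submodule.disjoint_def.2 fun x hxI hx => ?_
        obtain ⟨J, hJ, hxJ⟩ := (hmem x).1 hx
        exact Submodule.disjoint_def.1 (hc hJ).2 x hxI hxJ) ⊥ hbot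
  exact ⟨J, hJ⟩

theorem isHomogeneous_sup {I J : Submodule Qᵐᵒᵖ Q} (hI : I.IsHomogeneous ℬ)
    (hJ : J.IsHomogeneous ℬ) : (I ⊔ J).IsHomogeneous ℬ := by
  intro k x hx
  obtain ⟨a, ha, b, hb, rfl⟩ := Submodule.mem_sup.1 hx
  rw [decompose_add]
  exact add_mem (Submodule.mem_sup_left (hI k ha)) (Submodule.mem_sup_right (hJ k hb))

/-- The contraction of a right ideal along a ring homomorphism. -/
def contractRight (φ : R →+* Q) (I : Submodule Qᵐᵒᵖ Q) : Submodule Rᵐᵒᵖ R where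
  carrier := {r | φ r ∈ I}
  add_mem' := fun {a b} ha hb => by
    change φ (a + b) ∈ I
    rw [map_add]; exact I.add_mem ha hb
  zero_mem' := by simp
  smul_mem' := fun c x hx => by
    change φ (x * c.unop) ∈ I
    rw [map_mul]; exact mul_mem_rightIdeal I hx _

variable (φ : 𝒜 →+*ᵍ ℬ)
  (hφ : IsRightRingOfFractions (neutralRegular 𝒜) φ.toRingHom)
include hφ

omit [DecidableEq ι] [GradedRing 𝒜] [GradedRing ℬ] in
theorem injective_of_isRightRingOfFractions : Function.Injective φ := by
  rw [injective_iff_map_eq_zero]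
  intro r hr
  obtain ⟨s, hs, h⟩ := hφ.exists_of_map_eq_zero r hr
  exact hs.1.2.2 r h

/-- For `J` maximal among graded right ideals disjoint from `I`, the contraction of `I ⊔ J` is
gr-essential, so `I ⊔ J` contains a unit. -/
theorem isGrSemisimple_of_exists_mem_neutralRegular
    (hess : ∀ E, IsGrEssential 𝒜 E → ∃ s ∈ neutralRegular 𝒜, s ∈ E) : IsGrSemisimple ℬ := by
  classical
  intro I hI
  obtain ⟨J, ⟨hJ, hdisj⟩, hmax⟩ := exists_maximal_homogeneous_disjoint (ℬ := ℬ) I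
  have hIJ := isHomogeneous_sup hI hJ
  refine ⟨J, hJ, hdisj, ?_⟩
  suffices hE : IsGrEssential 𝒜 (contractRight φ.toRingHom (I ⊔ J)) by
    obtain ⟨s, hs, hsE⟩ := hess _ hE
    obtain ⟨u, hu⟩ := hφ.isUnit_map s hs
    rw [codisjoint_iff, eq_top_iff]
    intro q _
    have h : φ.toRingHom s ∈ I ⊔ J := hsE
    have := mul_mem_rightIdeal _ h (↑u⁻¹ * q)
    rwa [← hu, Units.mul_inv_cancel_left] at this
  intro x hx hx0
  by_contra! hcon
  have hφx : IsHomogeneousElem ℬ (φ x) := let ⟨g, hg⟩ := hx; ⟨g, φ.map_mem hg⟩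
  have hKdisj : Disjoint (I ⊔ J) (Submodule.span Qᵐᵒᵖ {φ x}) := by
    refine Submodule.disjoint_def.2 fun y hy hy' => ?_
    obtain ⟨q, rfl⟩ := mem_span_singleton_right.1 hy'
    obtain ⟨r, s, hs, hq⟩ := hφ.exists_fraction q
    change q * φ s = φ r at hq
    have hxr : φ x * φ r ∈ I ⊔ J := by
      rw [← hq, ← mul_assoc]; exact mul_mem_rightIdeal _ hy _
    have hxr0 : x * r = 0 := by
      rw [← DirectSum.sum_support_decompose 𝒜 r, Finset.mul_sum]
      refine Finset.sum_eq_zero fun i _ => hcon _ ⟨i, (decompose 𝒜 r i).2⟩ ?_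
      change φ (x * decompose 𝒜 r i) ∈ I ⊔ J
      have := mem_of_homogeneous_mul_mem hIJ hφx hxr i
      rw [DirectSum.decompose_map 𝒜 ℬ φ] at this
      rw [map_mul]
      exact this
    rw [← (hφ.isUnit_map s hs).mul_left_eq_zero]
    change φ x * q * φ s = 0
    rw [mul_assoc, hq, ← map_mul, hxr0, map_zero]
  -- Adjoining `φ x` to `J` would keep it disjoint from `I`.
  have hle := hmax ⟨isHomogeneous_sup hJ (isHomogeneous_span_singleton hφx),
    hdisj.disjoint_sup_right_of_disjoint_sup_left hKdisj⟩ le_sup_left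
  have hmem := self_mem_span_singleton_right (φ x)
  have h0 := Submodule.disjoint_def.1 hKdisj (φ x)
    (Submodule.mem_sup_right (hle (Submodule.mem_sup_right hmem))) hmem
  exact hx0 (injective_of_isRightRingOfFractions φ hφ (h0.trans (map_zero φ).symm))

omit [GradedRing ℬ] in
theorem isGrClassicalRightQuotientRing_of_isRightRingOfFractions
    (hp : ∀ g : ι, IsOfFinAddOrder g) : IsGrClassicalRightQuotientRing φ where
  isUnit_map s hs := by
    obtain ⟨n, hn⟩ := exists_pow_mem_zero hp hs.1
    have := hφ.isUnit_map (s ^ (n + 1)) ⟨⟨isHomogeneousElem_pow hs.1 _, pow_mem hs.2 _⟩, hn⟩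
    rw [map_pow] at this
    exact (isUnit_pow_iff n.succ_ne_zero).1 this
  exists_fraction q := by
    obtain ⟨r, s, hs, h⟩ := hφ.exists_fraction q
    exact ⟨r, s, hs.1, h⟩
  exists_of_map_eq_zero r hr := by
    obtain ⟨s, hs, h⟩ := hφ.exists_of_map_eq_zero r hr
    exact ⟨s, hs.1, h⟩

theorem isRightRingOfFractions_gradedZeroRingHom :
    IsRightRingOfFractions (((↑) : 𝒜 0 → R) ⁻¹' neutralRegular 𝒜)
      (GradedRingHom.gradedZeroRingHom φ) where
  isUnit_map s hs := by
    obtain ⟨u, hu⟩ := hφ.isUnit_map s hs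
    have hs0 : φ s ∈ ℬ 0 := φ.map_mem s.2
    have hinv : (↑u⁻¹ : Q) ∈ ℬ 0 := by
      have h1 : φ s * ↑u⁻¹ = 1 := by
        change φ.toRingHom s * ↑u⁻¹ = 1
        rw [← hu, Units.mul_inv]
      have h2 := decompose_mul_left_mem hs0 (↑u⁻¹ : Q) 0
      rw [h1, decompose_of_mem_same ℬ (one_mem_graded ℬ), neg_zero, zero_add] at h2
      -- The neutral part of `u⁻¹` is already a right inverse of the neutral element `φ s`.
      have h3 : (↑u⁻¹ : Q) = decompose ℬ (↑u⁻¹ : Q) 0 := by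
        have h4 : (↑u⁻¹ : Q) * (φ.toRingHom s * decompose ℬ (↑u⁻¹ : Q) 0) = ↑u⁻¹ * 1 :=
          congrArg _ h2.symm
        rw [mul_one, ← hu, Units.inv_mul_cancel_left] at h4
        exact h4.symm
      rw [h3]
      exact (decompose ℬ (↑u⁻¹ : Q) 0).2
    refine ⟨⟨⟨φ s, hs0⟩, ⟨_, hinv⟩, Subtype.ext ?_, Subtype.ext ?_⟩, rfl⟩
    · change φ.toRingHom s * ↑u⁻¹ = 1
      rw [← hu, Units.mul_inv]
    · change ↑u⁻¹ * φ.toRingHom s = 1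
      rw [← hu, Units.inv_mul]
  exists_fraction q := by
    obtain ⟨r, s, hs, h⟩ := hφ.exists_fraction q
    change (q : Q) * φ s = φ r at h
    refine ⟨decompose 𝒜 r 0, ⟨s, hs.2⟩, hs, Subtype.ext ?_⟩
    change (q : Q) * φ s = φ (decompose 𝒜 r 0)
    have h1 : φ r ∈ ℬ 0 := by
      rw [← h]
      simpa using mul_mem_graded q.2 (φ.map_mem hs.2)
    rw [h, ← decompose_of_mem_same ℬ h1, DirectSum.decompose_map 𝒜 ℬ φ]
    rfl
  exists_of_map_eq_zero r hr := by
    refine ⟨1, one_mem_neutralRegular, ?_⟩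
    rw [mul_one]
    exact Subtype.ext (injective_of_isRightRingOfFractions φ hφ
      ((congrArg Subtype.val hr).trans (map_zero φ).symm))

end Consequences

/-! ### Existence of the graded quotient ring for periodic groups -/

section Main

variable {ι : Type*} {R : Type v} [DecidableEq ι] [AddGroup ι] [Ring R]
  (𝒜 : ι → AddSubgroup R) [GradedRing 𝒜]

theorem exists_graded_quotient_ring (hp : ∀ g : ι, IsOfFinAddOrder g) (hsp : IsGrSemiprime 𝒜)
    (hG : IsRightGrGoldie 𝒜) :
    ∃ (Q : Type v) (_ : Ring Q) (ℬ : ι → AddSubgroup Q) (_ : GradedRing ℬ) (φ : 𝒜 →+*ᵍ ℬ),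
      IsGrClassicalRightQuotientRing φ ∧ IsGrSemisimple ℬ ∧
      IsRightRingOfFractions (neutralRegular 𝒜) φ.toRingHom ∧
      ((↑) : 𝒜 0 → R) ⁻¹' neutralRegular 𝒜 = (nonZeroDivisors (𝒜 0) : Set (𝒜 0)) ∧
      IsSemiprime (𝒜 0) ∧ IsRightGoldie (𝒜 0) ∧
      IsClassicalRightQuotientRing (GradedRingHom.gradedZeroRingHom φ) ∧
      IsRightRingOfFractions (((↑) : 𝒜 0 → R) ⁻¹' neutralRegular 𝒜)
        (GradedRingHom.gradedZeroRingHom φ) := by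
  obtain ⟨Q, _, ψ, hψ, hinj⟩ := exists_isRightRingOfFractions (neutralRegularSubmonoid 𝒜)
    (fun s hs => hs.1.2) (ore_neutralRegular hp hsp hG)
  have hore : HomogeneousOre 𝒜 := fun g r hr s hs => ore_homogeneous hp hsp hG hr hs
  let := fractionGradedRing hore hinj hψ
  let φ : 𝒜 →+*ᵍ fractionComponent hore ψ :=
    { ψ with map_mem := fun hx => map_mem_fractionComponent hore ψ hx }
  have hφ : IsRightRingOfFractions (neutralRegular 𝒜) φ.toRingHom := hψ
  have hreg := coe_preimage_neutralRegular hp hsp hG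
  have hzero := isRightRingOfFractions_gradedZeroRingHom φ hφ
  refine ⟨Q, _, _, _, φ, isGrClassicalRightQuotientRing_of_isRightRingOfFractions φ hφ hp,
    isGrSemisimple_of_exists_mem_neutralRegular φ hφ
      (fun E hE => hE.exists_mem_neutralRegular hp hsp hG), hφ, hreg,
    isSemiprime_zero hp hsp hG, isRightGoldie_zero hp hsp hG, ?_, hzero⟩
  rw [hreg] at hzero
  exact hzero

end Main

end GradedGoldie

namespace GradedGoldie

open Polynomial DirectSum SetLike

/-! ### The counterexample: two lines glued at the origin -/

section Counterexample

variable (K : Type v) [Field K]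

/-- The coordinate ring of two affine lines glued at the origin, that is `K[x, y] / (x y)`:
the pairs of polynomials with the same constant coefficient. -/
noncomputable def gluedLines : Subring (K[X] × K[X]) :=
  RingHom.eqLocus (constantCoeff.comp (RingHom.fst K[X] K[X]))
    (constantCoeff.comp (RingHom.snd K[X] K[X]))

variable {K}

theorem mem_gluedLines {r : K[X] × K[X]} : r ∈ gluedLines K ↔ r.1.coeff 0 = r.2.coeff 0 := Iff.rfl

namespace gluedLines

/-- A function on the first line that vanishes at the origin. -/
noncomputable def left (p : K[X]) : gluedLines K := ⟨(p * X, 0), by simp [mem_gluedLines]⟩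

/-- A function on the second line that vanishes at the origin. -/
noncomputable def right (p : K[X]) : gluedLines K := ⟨(0, p * X), by simp [mem_gluedLines]⟩

/-- A constant function. -/
noncomputable def const (a : K) : gluedLines K := ⟨(C a, C a), rfl⟩

theorem left_add (p q : K[X]) : left (p + q) = left p + left q :=
  Subtype.ext (Prod.ext (add_mul _ _ _) (add_zero _).symm)

theorem right_add (p q : K[X]) : right (p + q) = right p + right q :=
  Subtype.ext (Prod.ext (add_zero _).symm (add_mul _ _ _))

theorem mul_left (r : gluedLines K) (p : K[X]) : r * left p = left (r.1.1 * p) :=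
  Subtype.ext (Prod.ext (mul_assoc _ _ _).symm (mul_zero _))

theorem mul_right (r : gluedLines K) (p : K[X]) : r * right p = right (r.1.2 * p) :=
  Subtype.ext (Prod.ext (mul_zero _) (mul_assoc _ _ _).symm)

theorem left_eq_zero_iff {p : K[X]} : left p = 0 ↔ p = 0 :=
  ⟨fun h => (mul_eq_zero.1 (congrArg (fun r => r.1.1) h : p * X = 0)).resolve_right X_ne_zero,
    fun h => by subst h; exact Subtype.ext (Prod.ext (zero_mul _) rfl)⟩

theorem right_eq_zero_iff {p : K[X]} : right p = 0 ↔ p = 0 :=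
  ⟨fun h => (mul_eq_zero.1 (congrArg (fun r => r.1.2) h : p * X = 0)).resolve_right X_ne_zero,
    fun h => by subst h; exact Subtype.ext (Prod.ext rfl (zero_mul _))⟩

theorem eq_left_add_right_add_const (r : gluedLines K) :
    r = left r.1.1.divX + right r.1.2.divX + const (r.1.1.coeff 0) := by
  refine Subtype.ext (Prod.ext ?_ ?_)
  · change r.1.1 = r.1.1.divX * X + 0 + C (r.1.1.coeff 0)
    rw [add_zero, divX_mul_X_add]
  · change r.1.2 = 0 + r.1.2.divX * X + C (r.1.1.coeff 0)
    rw [zero_add, mem_gluedLines.1 r.2, divX_mul_X_add]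

end gluedLines

/-! ### Its grading by an element and its inverse -/

section Grading

variable {ι : Type*} [AddGroup ι]

/-- The polynomial `p` is homogeneous of degree `g` when the variable has degree `δ`. -/
def IsHomogeneousPoly (δ g : ι) (p : K[X]) : Prop := ∀ n : ℕ, n • δ ≠ g → p.coeff n = 0

theorem IsHomogeneousPoly.mul {δ g h : ι} {p q : K[X]} (hp : IsHomogeneousPoly δ g p)
    (hq : IsHomogeneousPoly δ h q) : IsHomogeneousPoly δ (g + h) (p * q) := by
  intro n hn
  rw [coeff_mul]
  refine Finset.sum_eq_zero fun ij hij => ?_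
  rw [Finset.HasAntidiagonal.mem_antidiagonal] at hij
  by_cases hi : ij.1 • δ = g
  · rw [hq ij.2 fun hj => hn (by rw [← hij, add_nsmul, hi, hj]), mul_zero]
  · rw [hp _ hi, zero_mul]

theorem isHomogeneousPoly_monomial (δ : ι) (n : ℕ) (a : K) :
    IsHomogeneousPoly δ (n • δ) (monomial n a) := by
  intro m hm
  rw [coeff_monomial, if_neg]
  rintro rfl
  exact hm rfl

theorem isHomogeneousPoly_zero (δ g : ι) : IsHomogeneousPoly δ g (0 : K[X]) := fun n _ => coeff_zero n

theorem isHomogeneousPoly_C (δ : ι) (a : K) : IsHomogeneousPoly δ 0 (C a) := by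
  simpa using isHomogeneousPoly_monomial δ 0 a

variable (K) in
/-- The grading of the glued lines in which the coordinates have degrees `γ` and `-γ`. -/
def gluedLinesGrading (γ g : ι) : AddSubgroup (gluedLines K) where
  carrier := {r | IsHomogeneousPoly γ g r.1.1 ∧ IsHomogeneousPoly (-γ) g r.1.2}
  zero_mem' := ⟨isHomogeneousPoly_zero _ _, isHomogeneousPoly_zero _ _⟩
  add_mem' := fun {a b} ha hb =>
    ⟨fun n hn => by
      change (a.1.1 + b.1.1).coeff n = 0
      rw [coeff_add, ha.1 n hn, hb.1 n hn, add_zero],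
    fun n hn => by
      change (a.1.2 + b.1.2).coeff n = 0
      rw [coeff_add, ha.2 n hn, hb.2 n hn, add_zero]⟩
  neg_mem' := fun {a} ha =>
    ⟨fun n hn => by
      change (-a.1.1).coeff n = 0
      rw [coeff_neg, ha.1 n hn, neg_zero],
    fun n hn => by
      change (-a.1.2).coeff n = 0
      rw [coeff_neg, ha.2 n hn, neg_zero]⟩

namespace gluedLines

theorem left_monomial_mem (γ : ι) (n : ℕ) (a : K) :
    left (monomial n a) ∈ gluedLinesGrading K γ ((n + 1) • γ) := by
  refine ⟨?_, isHomogeneousPoly_zero _ _⟩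
  change IsHomogeneousPoly _ _ (monomial n a * X)
  rw [monomial_mul_X]
  exact isHomogeneousPoly_monomial _ _ _

theorem right_monomial_mem (γ : ι) (n : ℕ) (a : K) :
    right (monomial n a) ∈ gluedLinesGrading K γ ((n + 1) • -γ) := by
  refine ⟨isHomogeneousPoly_zero _ _, ?_⟩
  change IsHomogeneousPoly _ _ (monomial n a * X)
  rw [monomial_mul_X]
  exact isHomogeneousPoly_monomial _ _ _

theorem const_mem (γ : ι) (a : K) : const a ∈ gluedLinesGrading K γ 0 :=
  ⟨isHomogeneousPoly_C _ _, isHomogeneousPoly_C _ _⟩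

variable [DecidableEq ι]

theorem coeff_fst_coeAddMonoidHom (γ : ι) (f : ⨁ g, gluedLinesGrading K γ g) (n : ℕ) :
    (DirectSum.coeAddMonoidHom (gluedLinesGrading K γ) f).1.1.coeff n =
      (f (n • γ)).1.1.1.coeff n := by
  induction f using DirectSum.induction_on with
  | zero => simp
  | of i x =>
    rw [DirectSum.coeAddMonoidHom_of]
    by_cases h : n • γ = i
    · subst h; rw [DirectSum.of_eq_same]
    · rw [DirectSum.of_eq_of_ne _ _ _ h, x.2.1 n h]; rfl
  | add x y hx hy =>
    rw [map_add, DirectSum.add_apply]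
    change ((DirectSum.coeAddMonoidHom (gluedLinesGrading K γ) x).1.1 +
      (DirectSum.coeAddMonoidHom (gluedLinesGrading K γ) y).1.1).coeff n =
      ((x (n • γ)).1.1.1 + (y (n • γ)).1.1.1).coeff n
    rw [coeff_add, coeff_add, hx, hy]

theorem coeff_snd_coeAddMonoidHom (γ : ι) (f : ⨁ g, gluedLinesGrading K γ g) (n : ℕ) :
    (DirectSum.coeAddMonoidHom (gluedLinesGrading K γ) f).1.2.coeff n =
      (f (n • -γ)).1.1.2.coeff n := by
  induction f using DirectSum.induction_on with
  | zero => simp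
  | of i x =>
    rw [DirectSum.coeAddMonoidHom_of]
    by_cases h : n • -γ = i
    · subst h; rw [DirectSum.of_eq_same]
    · rw [DirectSum.of_eq_of_ne _ _ _ h, x.2.2 n h]; rfl
  | add x y hx hy =>
    rw [map_add, DirectSum.add_apply]
    change ((DirectSum.coeAddMonoidHom (gluedLinesGrading K γ) x).1.2 +
      (DirectSum.coeAddMonoidHom (gluedLinesGrading K γ) y).1.2).coeff n =
      ((x (n • -γ)).1.1.2 + (y (n • -γ)).1.1.2).coeff n
    rw [coeff_add, coeff_add, hx, hy]

theorem isInternal_grading (γ : ι) : IsInternal (gluedLinesGrading K γ) := by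
  constructor
  · rw [injective_iff_map_eq_zero]
    intro f hf
    refine DFinsupp.ext fun g => Subtype.ext (Subtype.ext (Prod.ext
      (Polynomial.ext fun n => ?_) (Polynomial.ext fun n => ?_)))
    · by_cases h : n • γ = g
      · rw [← h, ← coeff_fst_coeAddMonoidHom, hf]; rfl
      · exact (f g).2.1 n h
    · by_cases h : n • -γ = g
      · rw [← h, ← coeff_snd_coeAddMonoidHom, hf]; rfl
      · exact (f g).2.2 n h
  · intro r
    change r ∈ (DirectSum.coeAddMonoidHom (gluedLinesGrading K γ)).range
    have hmem : ∀ {g} {x : gluedLines K}, x ∈ gluedLinesGrading K γ g →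
        x ∈ (DirectSum.coeAddMonoidHom (gluedLinesGrading K γ)).range := fun {g x} hx =>
      ⟨DirectSum.of (fun i => gluedLinesGrading K γ i) g ⟨x, hx⟩,
        DirectSum.coeAddMonoidHom_of _ _ _⟩
    rw [eq_left_add_right_add_const r]
    refine add_mem (add_mem ?_ ?_) (hmem (const_mem γ _))
    · induction r.1.1.divX using Polynomial.induction_on' with
      | add p q hp hq => rw [left_add]; exact add_mem hp hq
      | monomial n a => exact hmem (left_monomial_mem γ n a)
    · induction r.1.2.divX using Polynomial.induction_on' with
      | add p q hp hq => rw [right_add]; exact add_mem hp hq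
      | monomial n a => exact hmem (right_monomial_mem γ n a)

/-- The glued lines as a graded ring. -/
noncomputable instance gradedRing (γ : ι) : GradedRing (gluedLinesGrading K γ) :=
  { (isInternal_grading γ).chooseDecomposition with
    one_mem := const_mem γ 1
    mul_mem := fun _ _ _ _ ha hb => ⟨ha.1.mul hb.1, ha.2.mul hb.2⟩ }

theorem isGrSemiprime (γ : ι) : IsGrSemiprime (gluedLinesGrading K γ) := by
  rintro I - - ⟨n, hn⟩
  rw [eq_bot_iff]
  intro x hx
  have h := Ideal.pow_mem_pow hx n
  rw [hn, Ideal.zero_eq_bot, Ideal.mem_bot] at h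
  refine Subtype.ext (Prod.ext ?_ ?_)
  · exact eq_zero_of_pow_eq_zero (congrArg (fun r => r.1.1) h)
  · exact eq_zero_of_pow_eq_zero (congrArg (fun r => r.1.2) h)

omit [AddGroup ι] [DecidableEq ι] in
theorem exists_left_or_right_mem {I : Submodule (gluedLines K)ᵐᵒᵖ (gluedLines K)} (hI : I ≠ ⊥) :
    (∃ p, p ≠ 0 ∧ left p ∈ I) ∨ ∃ p, p ≠ 0 ∧ right p ∈ I := by
  obtain ⟨r, hr, hr0⟩ := Submodule.exists_mem_ne_zero_of_ne_bot hI
  by_cases h : r.1.1 = 0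
  · refine .inr ⟨r.1.2, fun h' => hr0 (Subtype.ext (Prod.ext h h')), ?_⟩
    have := mul_mem_rightIdeal I hr (right 1)
    rwa [mul_right, mul_one] at this
  · refine .inl ⟨r.1.1, h, ?_⟩
    have := mul_mem_rightIdeal I hr (left 1)
    rwa [mul_left, mul_one] at this

theorem isRightGrGoldie (γ : ι) : IsRightGrGoldie (gluedLinesGrading K γ) where
  no_infinite_direct_sum := by
    classical
    rintro ⟨I, -, hI, hind⟩
    -- By pigeonhole two of the ideals have nonzero elements supported on the same line; the product
    -- of these is nonzero and lies in both.
    obtain ⟨m, n, hmn, h⟩ := Finite.exists_ne_map_eq_of_infinite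
      fun n => decide (∃ p, p ≠ 0 ∧ left p ∈ I n)
    rw [decide_eq_decide] at h
    have hdisj := Submodule.disjoint_def.1 (hind.pairwiseDisjoint hmn)
    by_cases hm : ∃ p, p ≠ 0 ∧ left p ∈ I m
    · obtain ⟨p, hp, hpm⟩ := hm
      obtain ⟨q, hq, hqn⟩ := h.1 ⟨p, hp, hpm⟩
      have h0 := hdisj (left p * left q) (mul_mem_rightIdeal _ hpm _)
        (by rw [mul_comm]; exact mul_mem_rightIdeal _ hqn _)
      rw [mul_left, left_eq_zero_iff] at h0
      exact mul_ne_zero (mul_ne_zero hp X_ne_zero) hq h0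
    · obtain ⟨p, hp, hpm⟩ := (exists_left_or_right_mem (hI m)).resolve_left hm
      obtain ⟨q, hq, hqn⟩ := (exists_left_or_right_mem (hI n)).resolve_left (h.not.1 hm)
      have h0 := hdisj (right p * right q) (mul_mem_rightIdeal _ hpm _)
        (by rw [mul_comm]; exact mul_mem_rightIdeal _ hqn _)
      rw [mul_right, right_eq_zero_iff] at h0
      exact mul_ne_zero (mul_ne_zero hp X_ne_zero) hq h0
  max_condition := by
    intro C hC hann
    -- An annihilator depends only on which coordinates vanish on all of `Y`, so there are at most
    -- four.
    refine Set.Finite.exists_maximal (Set.Finite.subset (Set.finite_range fun b : Prop × Prop =>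
      rightAnnihilator {x : gluedLines K | (b.1 → x.1.1 = 0) ∧ (b.2 → x.1.2 = 0)})
      fun I hI => ?_) hC
    obtain ⟨-, Y, rfl⟩ := hann I hI
    refine ⟨(∀ x ∈ Y, x.1.1 = 0, ∀ x ∈ Y, x.1.2 = 0), le_antisymm ?_ ?_⟩
    · exact fun r hr x hx => hr x ⟨fun h => h x hx, fun h => h x hx⟩
    · rintro r hr x ⟨h1, h2⟩
      refine Subtype.ext (Prod.ext ?_ ?_)
      · change x.1.1 * r.1.1 = 0
        by_cases h : ∀ x ∈ Y, x.1.1 = 0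
        · rw [h1 h, zero_mul]
        · push Not at h
          obtain ⟨y, hy, hy0⟩ := h
          have : y.1.1 * r.1.1 = 0 := congrArg (fun r => r.1.1) (hr y hy)
          rw [(mul_eq_zero.1 this).resolve_left hy0, mul_zero]
      · change x.1.2 * r.1.2 = 0
        by_cases h : ∀ x ∈ Y, x.1.2 = 0
        · rw [h2 h, zero_mul]
        · push Not at h
          obtain ⟨y, hy, hy0⟩ := h
          have : y.1.2 * r.1.2 = 0 := congrArg (fun r => r.1.2) (hr y hy)
          rw [(mul_eq_zero.1 this).resolve_left hy0, mul_zero]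

omit [DecidableEq ι] in
-- Regularity makes both coordinates nonzero. Terms of exponents `n` and `m` in them give `n • γ = m
-- • -γ`, so `n + m = 0` and the element is constant.
theorem isUnit_of_mem_homogeneousRegular {γ : ι} (hγ : ¬ IsOfFinAddOrder γ) {s : gluedLines K}
    (hs : s ∈ homogeneousRegular (gluedLinesGrading K γ)) : IsUnit s := by
  obtain ⟨⟨g, hg⟩, hreg, -⟩ := hs
  have h1 : s.1.1 ≠ 0 := fun h => one_ne_zero (left_eq_zero_iff.1 (hreg (left 1) (by
    rw [mul_left, h, zero_mul, left_eq_zero_iff])) : (1 : K[X]) = 0)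
  have h2 : s.1.2 ≠ 0 := fun h => one_ne_zero (right_eq_zero_iff.1 (hreg (right 1) (by
    rw [mul_right, h, zero_mul, right_eq_zero_iff])) : (1 : K[X]) = 0)
  have hdeg1 : ∀ n, s.1.1.coeff n ≠ 0 → n • γ = g := fun n hn => not_not.1 fun h => hn (hg.1 n h)
  have hdeg2 : ∀ n, s.1.2.coeff n ≠ 0 → n • -γ = g := fun n hn => not_not.1 fun h => hn (hg.2 n h)
  have hzero : ∀ n m, s.1.1.coeff n ≠ 0 → s.1.2.coeff m ≠ 0 → n + m = 0 := by
    intro n m hn hm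
    have h := (hdeg1 n hn).trans (hdeg2 m hm).symm
    by_contra hne
    refine hγ (isOfFinAddOrder_iff_nsmul_eq_zero.2 ⟨n + m, Nat.pos_of_ne_zero hne, ?_⟩)
    rw [add_nsmul, h, neg_nsmul, neg_add_cancel]
  have hn := hzero _ _ (leadingCoeff_ne_zero.2 h1) (leadingCoeff_ne_zero.2 h2)
  have e1 := eq_C_of_natDegree_eq_zero (Nat.eq_zero_of_add_eq_zero_right hn)
  have e2 := eq_C_of_natDegree_eq_zero (Nat.eq_zero_of_add_eq_zero_left hn)
  have ha : s.1.1.coeff 0 ≠ 0 := fun h => h1 (by rw [e1, h, C_0])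
  refine IsUnit.of_mul_eq_one (const (s.1.1.coeff 0)⁻¹) (Subtype.ext (Prod.ext ?_ ?_))
  · change s.1.1 * C (s.1.1.coeff 0)⁻¹ = 1
    nth_rw 1 [e1]
    rw [← C_mul, mul_inv_cancel₀ ha, C_1]
  · change s.1.2 * C (s.1.1.coeff 0)⁻¹ = 1
    rw [e2, ← mem_gluedLines.1 s.2, ← C_mul, mul_inv_cancel₀ ha, C_1]

/-- Here `φ` is bijective. A complement to the ideal of `left 1` yields an idempotent whose first
coordinate is divisible by `X`, hence zero, so the complement is everything. -/
theorem not_exists_grSemisimple_quotient {γ : ι} (hγ : ¬ IsOfFinAddOrder γ) {Q : Type*} [Ring Q]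
    {ℬ : ι → AddSubgroup Q} [GradedRing ℬ] (φ : gluedLinesGrading K γ →+*ᵍ ℬ)
    (hφ : IsGrClassicalRightQuotientRing φ) : ¬ IsGrSemisimple ℬ := by
  intro hss
  have hinj : Function.Injective φ := by
    rw [injective_iff_map_eq_zero]
    intro r hr
    obtain ⟨s, hs, h⟩ := hφ.exists_of_map_eq_zero r hr
    exact hs.2.2 r h
  have hsurj : Function.Surjective φ := by
    intro q
    obtain ⟨r, s, hs, h⟩ := hφ.exists_fraction q
    obtain ⟨u, rfl⟩ := isUnit_of_mem_homogeneousRegular hγ hs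
    refine ⟨r * ↑u⁻¹, ?_⟩
    change q * φ u = φ r at h
    rw [map_mul, ← h, mul_assoc, ← map_mul, Units.mul_inv, map_one, mul_one]
  have hx : left (1 : K[X]) ∈ gluedLinesGrading K γ ((0 + 1) • γ) := left_monomial_mem γ 0 1
  obtain ⟨J, -, hdisj, hcodisj⟩ := hss (Submodule.span Qᵐᵒᵖ {φ (left 1)})
    (isHomogeneous_span_singleton ⟨_, φ.map_mem hx⟩)
  have h1 : (1 : Q) ∈ Submodule.span Qᵐᵒᵖ {φ (left 1)} ⊔ J := by
    rw [hcodisj.eq_top]; trivial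
  obtain ⟨u, hu, v, hv, huv⟩ := Submodule.mem_sup.1 h1
  have huv0 : u * v = 0 := by
    have hcomm : u * v = v * u := by
      rw [eq_sub_of_add_eq huv]; noncomm_ring
    exact Submodule.disjoint_def.1 hdisj _ (mul_mem_rightIdeal _ hu _)
      (hcomm ▸ mul_mem_rightIdeal _ hv _)
  have hidem : u * u = u := by
    calc u * u = u * (u + v) - u * v := by noncomm_ring
      _ = u := by rw [huv, huv0, mul_one, sub_zero]
  obtain ⟨q, rfl⟩ := mem_span_singleton_right.1 hu
  obtain ⟨r, rfl⟩ := hsurj q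
  rw [← map_mul, mul_comm, mul_left, mul_one] at hidem huv
  rw [← map_mul] at hidem
  have hp := congrArg (fun r => r.1.1) (hinj hidem)
  change r.1.1 * X * (r.1.1 * X) = r.1.1 * X at hp
  have hp0 : r.1.1 * X = 0 := by
    by_contra hne
    have := congrArg (coeff · 0) (mul_left_cancel₀ hne (hp.trans (mul_one _).symm))
    simp at this
  have hr0 : r.1.1 = 0 := (mul_eq_zero.1 hp0).resolve_right X_ne_zero
  rw [hr0, left_eq_zero_iff.2 rfl, map_zero, zero_add] at huv
  have hmem : φ (left 1) ∈ J := by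
    have := mul_mem_rightIdeal J hv (φ (left 1))
    rwa [huv, one_mul] at this
  have h0 := Submodule.disjoint_def.1 hdisj _ (self_mem_span_singleton_right _) hmem
  exact one_ne_zero (left_eq_zero_iff.1 (hinj (h0.trans (map_zero φ).symm)))

end gluedLines

end Grading

end Counterexample

end GradedGoldie

theorem theorem1 (G : Type u) [Group G] [DecidableEq G] :
    ((∀ (R : Type v) [Ring R] (𝒜 : Additive G → AddSubgroup R) [GradedRing 𝒜],
        IsGrSemiprime 𝒜 → IsRightGrGoldie 𝒜 →
        ∃ (Q : Type v) (_ : Ring Q) (ℬ : Additive G → AddSubgroup Q) (_ : GradedRing ℬ)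
          (φ : 𝒜 →+*ᵍ ℬ),
          IsGrClassicalRightQuotientRing φ ∧ IsGrSemisimple ℬ) ↔
      ∀ g : G, IsOfFinOrder g) ∧
    ((∀ g : G, IsOfFinOrder g) →
      ∀ (R : Type v) [Ring R] (𝒜 : Additive G → AddSubgroup R) [GradedRing 𝒜],
        IsGrSemiprime 𝒜 → IsRightGrGoldie 𝒜 →
        ∃ (Q : Type v) (_ : Ring Q) (ℬ : Additive G → AddSubgroup Q) (_ : GradedRing ℬ)
          (φ : 𝒜 →+*ᵍ ℬ),
          IsGrClassicalRightQuotientRing φ ∧ IsGrSemisimple ℬ ∧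
          IsRightRingOfFractions (neutralRegular 𝒜) φ.toRingHom ∧
          ((↑) : 𝒜 0 → R) ⁻¹' neutralRegular 𝒜 = (nonZeroDivisors (𝒜 0) : Set (𝒜 0)) ∧
          IsSemiprime (𝒜 0) ∧ IsRightGoldie (𝒜 0) ∧
          IsClassicalRightQuotientRing (GradedRingHom.gradedZeroRingHom φ) ∧
          IsRightRingOfFractions (((↑) : 𝒜 0 → R) ⁻¹' neutralRegular 𝒜)
            (GradedRingHom.gradedZeroRingHom φ)) := by
  have hadd : (∀ g : G, IsOfFinOrder g) → ∀ γ : Additive G, IsOfFinAddOrder γ := fun h γ =>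
    (isOfFinAddOrder_ofMul_iff (x := γ.toMul)).2 (h γ.toMul)
  refine ⟨⟨fun h g => ?_, fun hper R _ 𝒜 _ hsp hG => ?_⟩, fun hper R _ 𝒜 _ hsp hG =>
    exists_graded_quotient_ring 𝒜 (hadd hper) hsp hG⟩
  · by_contra hg
    have hγ : ¬ IsOfFinAddOrder (Additive.ofMul g) := fun h => hg (isOfFinAddOrder_ofMul_iff.1 h)
    -- Any field would do; `ULift` places `ℚ` in the required universe.
    obtain ⟨Q, _, ℬ, _, φ, hφ, hss⟩ := h (gluedLines (ULift.{v} ℚ))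
      (gluedLinesGrading (ULift.{v} ℚ) (Additive.ofMul g)) (gluedLines.isGrSemiprime _)
      (gluedLines.isRightGrGoldie _)
    exact gluedLines.not_exists_grSemisimple_quotient hγ φ hφ hss
  · obtain ⟨Q, i₁, ℬ, i₂, φ, h₁, h₂, -⟩ := exists_graded_quotient_ring 𝒜 (hadd hper) hsp hG
    exact ⟨Q, i₁, ℬ, i₂, φ, h₁, h₂⟩
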